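/- **Notation.** A net $(x_\varepsilon)_\varepsilon\in\mathbb C^{(0,1)}$ is moderate if $|x_\varepsilon|\le\varepsilon^{-N}$ for small $\varepsilon$, for some $N\in\mathbb N$, and negligible if $|x_\varepsilon|\le\varepsilon^{m}$ for small $\varepsilon$, for every $m\in\mathbb N$. $\widetilde{\mathbb C}$ is the ring of moderate nets modulo the ideal of negligible nets. For $\tilde z=[(z_\varepsilon)_\varepsilon]\in\widetilde{\mathbb C}$ let $\mathrm v(\tilde z)=\sup\{b\in\mathbb R: |z_\varepsilon|\le\varepsilon^b\text{ for small }\varepsilon\}$ and let $|\tilde z|_{\mathrm e}=e^{-\mathrm v(\tilde z)}$ be the sharp norm; the topology of the metric $|\tilde z-\tilde w|_{\mathrm e}$ is the sharp topology. For $\emptyset\ne A\subseteq\widetilde{\mathbb C}$, $\widetilde{\mathcal G}(A)=\mathcal E_M(A)/\mathcal N(A)$, where $\mathcal E_M(A)$ (resp. $\mathcal N(A)$) is the set of nets $(u_\varepsilon)_\varepsilon$ of functions in $\mathcal C^\infty(\mathbb R^2)$ (with values in $\mathbb C$, and $\mathbb R^2=\mathbb C$) such that $(\partial^\alpha u_\varepsilon(x_\varepsilon))_\varepsilon$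 is moderate (resp. negligible) for every $\alpha\in\mathbb N^2$ and every representative $(x_\varepsilon)_\varepsilon$ of every element of $A$. Derivatives act on representatives, $\bar\partial=\frac12(\partial_x+i\partial_y)$, the point value of $u=[(u_\varepsilon)_\varepsilon]$ at $\tilde z=[(z_\varepsilon)_\varepsilon]\in A$ is $u(\tilde z)=[(u_\varepsilon(z_\varepsilon))_\varepsilon]\in\widetilde{\mathbb C}$, and $\widetilde{\mathcal G}_H(A)=\{u\in\widetilde{\mathcal G}(A):\bar\partial u=0\}$ for open $A$. **Theorem.** Let $\tilde z_0\in\widetilde{\mathbb C}$, let $r>0$ be a real number, and let $A=\{\tilde z\in\widetilde{\mathbb C}: |\tilde z-\tilde z_0|_{\mathrm e}<r\}$. The following are equivalent: 1. $u\in\widetilde{\mathcal G}_H(A)$; 2. $u\in\widetilde{\mathcal G}(A)$, $\limsup_{|\alpha|\to\infty}\sqrt[|\alpha|]{|\partial^\alpha u(\tilde z)|_{\mathrm e}}\le 1/r$ for every $\tilde z\in A$, and $\bar\partial u=0$ in $\widetilde{\mathcal G}(\{\tilde z_0\})$, i.e. $\partial^\alpha\bar\partial u(\tilde z_0)=0$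 for every $\alpha\in\mathbb N^2$; 3. there are $a_n\in\widetilde{\mathbb C}$ ($n\in\mathbb N$) such that, for every $\tilde z\in A$, $u(\tilde z)=\sum_{n=0}^\infty a_n(\tilde z-\tilde z_0)^n$, with convergence in the sharp topology; 4. $u\in\widetilde{\mathcal G}(A)$ has a representative $(u_\varepsilon)_\varepsilon\in\mathcal E_M(A)$ with $u_\varepsilon\in\mathbb C[z]$ for every $\varepsilon$. This holds for every $u\in\widetilde{\mathcal G}(A)$, (3) being a condition on its point values, and also for every map $u:A\to\widetilde{\mathbb C}$, where (1), (2), (4) mean that $u$ is the map of point values of some element of $\widetilde{\mathcal G}(A)$ with the stated property. -/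

import Mathlib

open Filter Topology
open scoped ContDiff

namespace Colombeau

/-- The parameter interval `(0,1)`. The filter `atBot` on it expresses "for small `ε`". -/
abbrev Eps : Type := Set.Ioo (0 : ℝ) 1

/-! ### Generalized complex numbers -/

/-- The net `x` is moderate: `|x_ε| ≤ ε^{-N}` for small `ε`, for some `N`. -/
def IsModerate (x : Eps → ℂ) : Prop :=
  ∃ N : ℕ, ∀ᶠ ε : Eps in atBot, ‖x ε‖ ≤ (ε : ℝ) ^ (-(N : ℤ))

/-- The net `x` is negligible: `|x_ε| ≤ ε^m` for small `ε`, for every `m`. -/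
def IsNegligible (x : Eps → ℂ) : Prop :=
  ∀ m : ℕ, ∀ᶠ ε : Eps in atBot, ‖x ε‖ ≤ (ε : ℝ) ^ m

lemma eventually_lt {c : ℝ} (hc : 0 < c) : ∀ᶠ ε : Eps in atBot, (ε : ℝ) < c := by
  have h : 0 < min c 1 / 2 := by positivity
  have h1 : min c 1 / 2 < 1 := by linarith [min_le_right c 1]
  filter_upwards [eventually_le_atBot (⟨min c 1 / 2, h, h1⟩ : Eps)] with ε hε
  have h2 : (ε : ℝ) ≤ min c 1 / 2 := hε
  linarith [min_le_left c 1]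

/-- A constant factor can be absorbed into one power of `ε`. -/
lemma IsModerate.of_le {x : Eps → ℂ} (C : ℝ) (N : ℕ)
    (h : ∀ᶠ ε : Eps in atBot, ‖x ε‖ ≤ C * (ε : ℝ) ^ (-(N : ℤ))) : IsModerate x := by
  refine ⟨N + 1, ?_⟩
  have hC : 0 < (|C| + 1)⁻¹ := by positivity
  filter_upwards [h, eventually_lt hC] with ε h1 h2
  have hε : 0 < (ε : ℝ) := ε.2.1
  refine h1.trans ?_
  have h3 : (ε : ℝ) ^ (-((N + 1 : ℕ) : ℤ)) = (ε : ℝ)⁻¹ * (ε : ℝ) ^ (-(N : ℤ)) := by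
    rw [← zpow_neg_one, ← zpow_add₀ hε.ne']; congr 1; push_cast; ring
  rw [h3]
  have h4 : C ≤ (ε : ℝ)⁻¹ := by
    have := (lt_inv_comm₀ hε (by positivity)).1 h2
    linarith [le_abs_self C]
  gcongr

lemma IsNegligible.of_le {x : Eps → ℂ} (C : ℝ) (N : ℕ)
    (h : ∀ m : ℕ, ∀ᶠ ε : Eps in atBot, ‖x ε‖ ≤ C * (ε : ℝ) ^ (-(N : ℤ)) * (ε : ℝ) ^ m) :
    IsNegligible x := by
  intro m
  have hC : 0 < (|C| + 1)⁻¹ := by positivity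
  filter_upwards [h (m + N + 1), eventually_lt hC] with ε h1 h2
  have hε : 0 < (ε : ℝ) := ε.2.1
  refine h1.trans ?_
  have h4 : C * ε ≤ 1 := by
    have := (lt_inv_comm₀ hε (by positivity)).1 h2
    have h5 : C ≤ (ε : ℝ)⁻¹ := by linarith [le_abs_self C]
    calc C * ε ≤ (ε : ℝ)⁻¹ * ε := by gcongr
      _ = 1 := inv_mul_cancel₀ hε.ne'
  have h6 : C * (ε : ℝ) ^ (-(N : ℤ)) * (ε : ℝ) ^ (m + N + 1) = (C * ε) * (ε : ℝ) ^ m := by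
    rw [zpow_neg, zpow_natCast]
    field_simp
    ring
  rw [h6]
  exact mul_le_of_le_one_left (by positivity) h4

lemma IsModerate.add {x y : Eps → ℂ} (hx : IsModerate x) (hy : IsModerate y) :
    IsModerate (x + y) := by
  obtain ⟨N, hN⟩ := hx
  obtain ⟨M, hM⟩ := hy
  refine IsModerate.of_le 2 (max N M) ?_
  filter_upwards [hN, hM] with ε h1 h2
  have hε : 0 < (ε : ℝ) := ε.2.1
  have e1 : (ε : ℝ) ^ (-(N : ℤ)) ≤ (ε : ℝ) ^ (-((max N M : ℕ) : ℤ)) :=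
    zpow_le_zpow_right_of_le_one₀ hε ε.2.2.le (by simp)
  have e2 : (ε : ℝ) ^ (-(M : ℤ)) ≤ (ε : ℝ) ^ (-((max N M : ℕ) : ℤ)) :=
    zpow_le_zpow_right_of_le_one₀ hε ε.2.2.le (by simp)
  have := norm_add_le (x ε) (y ε)
  simp only [Pi.add_apply]
  linarith

lemma IsModerate.mul {x y : Eps → ℂ} (hx : IsModerate x) (hy : IsModerate y) :
    IsModerate (x * y) := by
  obtain ⟨N, hN⟩ := hx
  obtain ⟨M, hM⟩ := hy
  refine ⟨N + M, ?_⟩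
  filter_upwards [hN, hM] with ε h1 h2
  have hε : 0 < (ε : ℝ) := ε.2.1
  have h3 : (ε : ℝ) ^ (-((N + M : ℕ) : ℤ)) = (ε : ℝ) ^ (-(N : ℤ)) * (ε : ℝ) ^ (-(M : ℤ)) := by
    rw [← zpow_add₀ hε.ne']; congr 1; push_cast; ring
  rw [Pi.mul_apply, norm_mul, h3]
  gcongr

lemma IsModerate.neg {x : Eps → ℂ} (hx : IsModerate x) : IsModerate (-x) := by
  simpa [IsModerate] using hx

lemma IsModerate.const (c : ℂ) : IsModerate (fun _ => c) :=
  IsModerate.of_le ‖c‖ 0 (by simp)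

lemma IsNegligible.add {x y : Eps → ℂ} (hx : IsNegligible x) (hy : IsNegligible y) :
    IsNegligible (x + y) := by
  refine IsNegligible.of_le 2 0 fun m => ?_
  filter_upwards [hx m, hy m] with ε h1 h2
  have := norm_add_le (x ε) (y ε)
  simp only [Pi.add_apply, Nat.cast_zero, neg_zero, zpow_zero, mul_one]
  linarith

lemma IsNegligible.moderate_mul {x y : Eps → ℂ} (hx : IsModerate x) (hy : IsNegligible y) :
    IsNegligible (x * y) := by
  obtain ⟨N, hN⟩ := hx
  refine IsNegligible.of_le 1 N fun m => ?_
  filter_upwards [hN, hy m] with ε h1 h2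
  have hε : 0 < (ε : ℝ) := ε.2.1
  rw [Pi.mul_apply, norm_mul, one_mul]
  gcongr

lemma IsNegligible.zero : IsNegligible 0 := by
  intro m
  filter_upwards with ε
  have hε : 0 < (ε : ℝ) := ε.2.1
  simpa using (pow_pos hε m).le

lemma IsNegligible.isModerate {x : Eps → ℂ} (hx : IsNegligible x) : IsModerate x :=
  ⟨0, by simpa using hx 0⟩

/-- The ring `𝓜_ℂ` of moderate nets. -/
def moderate : Subring (Eps → ℂ) where
  carrier := {x | IsModerate x}
  mul_mem' := IsModerate.mul
  one_mem' := IsModerate.const 1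
  add_mem' := IsModerate.add
  zero_mem' := IsModerate.const 0
  neg_mem' := IsModerate.neg

/-- The ideal `𝓝_ℂ` of negligible nets. -/
def negligible : Ideal moderate where
  carrier := {x | IsNegligible (x : Eps → ℂ)}
  add_mem' := IsNegligible.add
  zero_mem' := IsNegligible.zero
  smul_mem' := fun c _ hx => IsNegligible.moderate_mul c.2 hx

/-- The ring `ℂ̃ = 𝓜_ℂ / 𝓝_ℂ` of generalized complex numbers. -/
abbrev GenC : Type := moderate ⧸ negligible

/-- The class `[(x_ε)_ε]` of a moderate net. -/
def toGenC (x : moderate) : GenC := Ideal.Quotient.mk negligible x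

lemma toGenC_eq_iff {x y : moderate} :
    toGenC x = toGenC y ↔ IsNegligible ((x : Eps → ℂ) - y) := Ideal.Quotient.eq

/-! ### Valuation and sharp norm -/

/-- `v(x_ε) = sup {b ∈ ℝ : |x_ε| ≤ ε^b for small ε}`. -/
noncomputable def netValuation (x : Eps → ℂ) : EReal :=
  ⨆ b ∈ {b : ℝ | ∀ᶠ ε : Eps in atBot, ‖x ε‖ ≤ (ε : ℝ) ^ b}, (b : EReal)

lemma netValuation_le {x y : Eps → ℂ} (h : IsNegligible (x - y)) :
    netValuation x ≤ netValuation y := by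
  refine iSup₂_le fun b hb => ?_
  refine EReal.ge_of_forall_gt_iff_ge.1 fun c hc => ?_
  have hc' : c < b := by exact_mod_cast hc
  refine le_iSup₂ (f := fun (b : ℝ) (_ : b ∈ {b : ℝ | ∀ᶠ ε : Eps in atBot,
    ‖y ε‖ ≤ (ε : ℝ) ^ b}) => (b : EReal)) c ?_
  obtain ⟨m, hm⟩ := exists_nat_ge b
  have hp : 0 < ((1 : ℝ) / 2) ^ (1 / (b - c)) := by positivity
  filter_upwards [h m, hb, eventually_lt hp] with ε h1 h2 h3
  have hε : 0 < (ε : ℝ) := ε.2.1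
  have e1 : (ε : ℝ) ^ m ≤ (ε : ℝ) ^ b := by
    rw [← Real.rpow_natCast]
    exact Real.rpow_le_rpow_of_exponent_ge hε ε.2.2.le hm
  have e2 : (ε : ℝ) ^ (b - c) ≤ 1 / 2 := by
    have := Real.rpow_le_rpow hε.le h3.le (sub_pos.2 hc').le
    rwa [← Real.rpow_mul (by norm_num), one_div_mul_cancel (sub_pos.2 hc').ne',
      Real.rpow_one] at this
  have e3 : (ε : ℝ) ^ b = (ε : ℝ) ^ (b - c) * (ε : ℝ) ^ c := by
    rw [← Real.rpow_add hε]; congr 1; ring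
  have e4 : 0 < (ε : ℝ) ^ c := by positivity
  have e5 : ‖y ε‖ ≤ ‖x ε‖ + ‖(x - y) ε‖ := by
    have := norm_sub_le (x ε) ((x - y) ε)
    simpa using this
  nlinarith

/-- The valuation on `ℂ̃`, with values in `(-∞, ∞]`. -/
noncomputable def valuation (z : GenC) : EReal :=
  Quotient.liftOn' z (fun x => netValuation (x : Eps → ℂ)) (by
    intro x y hxy
    have h : IsNegligible ((x : Eps → ℂ) - y) :=
      toGenC_eq_iff.1 (Quotient.sound' hxy)
    have h' : IsNegligible ((y : Eps → ℂ) - x) :=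
      toGenC_eq_iff.1 (Quotient.sound' hxy).symm
    exact le_antisymm (netValuation_le h) (netValuation_le h'))

/-- The sharp norm `e^{-v(z)}`, with `e^{-∞} = 0`. -/
noncomputable def sharpNorm (z : GenC) : ℝ := (EReal.exp (-valuation z)).toReal

/-- The open ball `{z : ‖z - z₀‖♯ < r}`. -/
def sharpBall (z₀ : GenC) (r : ℝ) : Set GenC := {z | sharpNorm (z - z₀) < r}

lemma sharpNorm_zero : sharpNorm 0 = 0 := by
  have h : valuation 0 = ⊤ := by
    change netValuation 0 = ⊤
    refine EReal.eq_top_iff_forall_lt _ |>.2 fun b => ?_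
    refine lt_of_lt_of_le (b := ((b + 1 : ℝ) : EReal)) (by exact_mod_cast lt_add_one b) ?_
    refine le_iSup₂ (f := fun (b : ℝ) (_ : b ∈ {b : ℝ | ∀ᶠ ε : Eps in atBot,
      ‖(0 : Eps → ℂ) ε‖ ≤ (ε : ℝ) ^ b}) => (b : EReal)) (b + 1) ?_
    filter_upwards with ε
    have hε : 0 < (ε : ℝ) := ε.2.1
    simpa using Real.rpow_nonneg hε.le _
  simp [sharpNorm, h]

lemma mem_sharpBall_self (z₀ : GenC) {r : ℝ} (hr : 0 < r) : z₀ ∈ sharpBall z₀ r := by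
  simpa [sharpBall, sharpNorm_zero] using hr

/-- `∑ a_n` converges to `s` in the sharp topology: the partial sums converge to `s` for the
metric `d(z, w) = ‖z - w‖♯`. -/
def SharpHasSum (a : ℕ → GenC) (s : GenC) : Prop :=
  Tendsto (fun N => sharpNorm (∑ n ∈ Finset.range N, a n - s)) atTop (𝓝 0)

/-! ### Partial derivatives of smooth functions on `ℂ = ℝ²` -/

/-- The derivative in the (real) direction `v`; `v = 1` gives `∂_x` and `v = i` gives `∂_y`. -/
noncomputable def dirDeriv (v : ℂ) (f : ℂ → ℂ) : ℂ → ℂ := fun z => fderiv ℝ f z v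

/-- `∂^α = ∂_x^{α₁} ∂_y^{α₂}`. -/
noncomputable def partialDeriv (α : ℕ × ℕ) (f : ℂ → ℂ) : ℂ → ℂ :=
  (dirDeriv 1)^[α.1] ((dirDeriv Complex.I)^[α.2] f)

lemma dirDeriv_smooth (v : ℂ) {f : ℂ → ℂ} (hf : ContDiff ℝ ∞ f) :
    ContDiff ℝ ∞ (dirDeriv v f) :=
  (hf.fderiv_right (m := ∞) (by norm_num)).clm_apply contDiff_const

lemma dirDeriv_iter_smooth (v : ℂ) (n : ℕ) {f : ℂ → ℂ} (hf : ContDiff ℝ ∞ f) :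
    ContDiff ℝ ∞ ((dirDeriv v)^[n] f) := by
  induction n with
  | zero => exact hf
  | succ n ih => rw [Function.iterate_succ_apply']; exact dirDeriv_smooth v ih

lemma dirDeriv_add (v : ℂ) {f g : ℂ → ℂ} (hf : ContDiff ℝ ∞ f) (hg : ContDiff ℝ ∞ g) :
    dirDeriv v (f + g) = dirDeriv v f + dirDeriv v g := by
  ext z
  simp [dirDeriv, fderiv_add (hf.differentiable (by simp) z) (hg.differentiable (by simp) z)]

lemma dirDeriv_smul (v c : ℂ) {f : ℂ → ℂ} (hf : ContDiff ℝ ∞ f) :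
    dirDeriv v (c • f) = c • dirDeriv v f := by
  ext z
  simp [dirDeriv, fderiv_const_smul (hf.differentiable (by simp) z) c]

lemma dirDeriv_iter_add (v : ℂ) (n : ℕ) {f g : ℂ → ℂ} (hf : ContDiff ℝ ∞ f)
    (hg : ContDiff ℝ ∞ g) :
    (dirDeriv v)^[n] (f + g) = (dirDeriv v)^[n] f + (dirDeriv v)^[n] g := by
  induction n with
  | zero => rfl
  | succ n ih =>
    rw [Function.iterate_succ_apply', ih, dirDeriv_add v (dirDeriv_iter_smooth v n hf)
      (dirDeriv_iter_smooth v n hg), Function.iterate_succ_apply', Function.iterate_succ_apply']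

lemma dirDeriv_iter_smul (v c : ℂ) (n : ℕ) {f : ℂ → ℂ} (hf : ContDiff ℝ ∞ f) :
    (dirDeriv v)^[n] (c • f) = c • (dirDeriv v)^[n] f := by
  induction n with
  | zero => rfl
  | succ n ih =>
    rw [Function.iterate_succ_apply', ih, dirDeriv_smul v c (dirDeriv_iter_smooth v n hf),
      Function.iterate_succ_apply']

lemma partialDeriv_add (α : ℕ × ℕ) {f g : ℂ → ℂ} (hf : ContDiff ℝ ∞ f) (hg : ContDiff ℝ ∞ g) :
    partialDeriv α (f + g) = partialDeriv α f + partialDeriv α g := by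
  rw [partialDeriv, dirDeriv_iter_add _ _ hf hg, dirDeriv_iter_add _ _
    (dirDeriv_iter_smooth _ _ hf) (dirDeriv_iter_smooth _ _ hg)]
  rfl

lemma partialDeriv_smul (α : ℕ × ℕ) (c : ℂ) {f : ℂ → ℂ} (hf : ContDiff ℝ ∞ f) :
    partialDeriv α (c • f) = c • partialDeriv α f := by
  rw [partialDeriv, dirDeriv_iter_smul _ _ _ hf, dirDeriv_iter_smul _ _ _
    (dirDeriv_iter_smooth _ _ hf)]
  rfl

lemma dirDeriv_comm (v w : ℂ) {f : ℂ → ℂ} (hf : ContDiff ℝ ∞ f) :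
    dirDeriv v (dirDeriv w f) = dirDeriv w (dirDeriv v f) := by
  have hd : Differentiable ℝ (fderiv ℝ f) :=
    (hf.fderiv_right (m := ∞) (by norm_num)).differentiable (by simp)
  have key : ∀ v w z, dirDeriv v (dirDeriv w f) z = fderiv ℝ (fderiv ℝ f) z v w := by
    intro v w z
    change fderiv ℝ (fun y => fderiv ℝ f y w) z v = _
    rw [fderiv_clm_apply (hd z) (differentiableAt_const w)]
    simp
  ext z
  rw [key, key]
  exact (hf.contDiffAt.isSymmSndFDerivAt (by
    rw [minSmoothness_of_isRCLikeNormedField]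
    exact WithTop.coe_le_coe.2 (le_top : (2 : ℕ∞) ≤ ⊤))).eq v w

lemma partialDeriv_dy (α : ℕ × ℕ) (f : ℂ → ℂ) :
    partialDeriv α (dirDeriv Complex.I f) = partialDeriv (α.1, α.2 + 1) f := rfl

lemma partialDeriv_dx (α : ℕ × ℕ) {f : ℂ → ℂ} (hf : ContDiff ℝ ∞ f) :
    partialDeriv α (dirDeriv 1 f) = partialDeriv (α.1 + 1, α.2) f := by
  have h : ∀ n : ℕ, (dirDeriv Complex.I)^[n] (dirDeriv 1 f)
      = dirDeriv 1 ((dirDeriv Complex.I)^[n] f) := by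
    intro n
    induction n with
    | zero => rfl
    | succ n ih =>
      rw [Function.iterate_succ_apply', ih, dirDeriv_comm _ _ (dirDeriv_iter_smooth _ n hf),
        Function.iterate_succ_apply']
  simp only [partialDeriv, h]
  rfl

/-! ### Generalized functions on a subset of `ℂ̃` -/

/-- `𝓔_M(A)`: nets of smooth functions all of whose partial derivatives are moderate along each
representative of each point of `A`. -/
def EModerate (A : Set GenC) : Submodule ℂ (Eps → ℂ → ℂ) where
  carrier := {u | (∀ ε, ContDiff ℝ ∞ (u ε)) ∧ ∀ α : ℕ × ℕ, ∀ x : moderate, toGenC x ∈ A →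
    IsModerate (fun ε => partialDeriv α (u ε) ((x : Eps → ℂ) ε))}
  add_mem' := by
    rintro u v ⟨hu, hu'⟩ ⟨hv, hv'⟩
    refine ⟨fun ε => (hu ε).add (hv ε), fun α x hx => ?_⟩
    have := (hu' α x hx).add (hv' α x hx)
    convert this using 2 with ε
    exact congrFun (partialDeriv_add α (hu ε) (hv ε)) _
  zero_mem' := by
    refine ⟨fun ε => contDiff_const, fun α x hx => ?_⟩
    have h : ∀ ε : Eps, partialDeriv α ((0 : Eps → ℂ → ℂ) ε) = 0 := fun ε => by
      have := partialDeriv_smul α 0 (f := 0) contDiff_const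
      simpa using this
    simp only [h]
    exact IsModerate.const 0
  smul_mem' := by
    rintro c u ⟨hu, hu'⟩
    refine ⟨fun ε => (hu ε).const_smul c, fun α x hx => ?_⟩
    have := (IsModerate.const c).mul (hu' α x hx)
    convert this using 2 with ε
    exact congrFun (partialDeriv_smul α c (hu ε)) _

/-- `𝓝(A)`: nets of smooth functions all of whose partial derivatives are negligible along each
representative of each point of `A`. -/
def ENegligible (A : Set GenC) : Submodule ℂ (Eps → ℂ → ℂ) where
  carrier := {u | (∀ ε, ContDiff ℝ ∞ (u ε)) ∧ ∀ α : ℕ × ℕ, ∀ x : moderate, toGenC x ∈ A →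
    IsNegligible (fun ε => partialDeriv α (u ε) ((x : Eps → ℂ) ε))}
  add_mem' := by
    rintro u v ⟨hu, hu'⟩ ⟨hv, hv'⟩
    refine ⟨fun ε => (hu ε).add (hv ε), fun α x hx => ?_⟩
    have := (hu' α x hx).add (hv' α x hx)
    convert this using 2 with ε
    exact congrFun (partialDeriv_add α (hu ε) (hv ε)) _
  zero_mem' := by
    refine ⟨fun ε => contDiff_const, fun α x hx => ?_⟩
    have h : ∀ ε : Eps, partialDeriv α ((0 : Eps → ℂ → ℂ) ε) = 0 := fun ε => by
      have := partialDeriv_smul α 0 (f := 0) contDiff_const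
      simpa using this
    simp only [h]
    exact IsNegligible.zero
  smul_mem' := by
    rintro c u ⟨hu, hu'⟩
    refine ⟨fun ε => (hu ε).const_smul c, fun α x hx => ?_⟩
    have := IsNegligible.moderate_mul (IsModerate.const c) (hu' α x hx)
    convert this using 2 with ε
    exact congrFun (partialDeriv_smul α c (hu ε)) _

/-- `𝓖̃(A) = 𝓔_M(A) / 𝓝(A)`. -/
abbrev Gen (A : Set GenC) : Type := EModerate A ⧸ (ENegligible A).submoduleOf (EModerate A)

/-- The class `[(u_ε)_ε]` in `𝓖̃(A)`. -/
def toGen {A : Set GenC} (u : EModerate A) : Gen A := Submodule.Quotient.mk u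

/-- `∂_x` or `∂_y` on `𝓔_M(A)`, by derivation of each `u_ε`. -/
noncomputable def netDeriv (A : Set GenC) (v : ℂ) (σ : ℕ × ℕ → ℕ × ℕ)
    (h : ∀ α f, ContDiff ℝ ∞ f → partialDeriv α (dirDeriv v f) = partialDeriv (σ α) f) :
    EModerate A →ₗ[ℂ] EModerate A where
  toFun u := ⟨fun ε => dirDeriv v (u.1 ε), fun ε => dirDeriv_smooth v (u.2.1 ε), fun α x hx => by
    simpa only [h α _ (u.2.1 _)] using u.2.2 (σ α) x hx⟩
  map_add' u w := by
    ext1; funext ε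
    exact dirDeriv_add v (u.2.1 ε) (w.2.1 ε)
  map_smul' c u := by
    ext1; funext ε
    exact dirDeriv_smul v c (u.2.1 ε)

/-- The operation induced by `netDeriv` on `𝓖̃(A)`. -/
noncomputable def genDeriv (A : Set GenC) (v : ℂ) (σ : ℕ × ℕ → ℕ × ℕ)
    (h : ∀ α f, ContDiff ℝ ∞ f → partialDeriv α (dirDeriv v f) = partialDeriv (σ α) f) :
    Gen A →ₗ[ℂ] Gen A :=
  Submodule.mapQ _ _ (netDeriv A v σ h) (by
    rintro u ⟨hu, hu'⟩
    refine ⟨fun ε => dirDeriv_smooth v (u.2.1 ε), fun α x hx => ?_⟩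
    have : IsNegligible (fun ε => partialDeriv (σ α) (u.1 ε) ((x : Eps → ℂ) ε)) :=
      hu' (σ α) x hx
    change IsNegligible (fun ε => partialDeriv α (dirDeriv v (u.1 ε)) _)
    simpa only [h α _ (u.2.1 _)] using this)

/-- `∂_x` on `𝓖̃(A)`: `∂_x [(u_ε)_ε] = [(∂_x u_ε)_ε]`. -/
noncomputable def genDx {A : Set GenC} : Gen A →ₗ[ℂ] Gen A :=
  genDeriv A 1 (fun α => (α.1 + 1, α.2)) (fun α _ hf => partialDeriv_dx α hf)

/-- `∂_y` on `𝓖̃(A)`: `∂_y [(u_ε)_ε] = [(∂_y u_ε)_ε]`. -/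
noncomputable def genDy {A : Set GenC} : Gen A →ₗ[ℂ] Gen A :=
  genDeriv A Complex.I (fun α => (α.1, α.2 + 1)) (fun α f _ => partialDeriv_dy α f)

/-- `∂^α = ∂_x^{α₁} ∂_y^{α₂}` on `𝓖̃(A)`. -/
noncomputable def genPartial {A : Set GenC} (α : ℕ × ℕ) (U : Gen A) : Gen A :=
  genDx^[α.1] (genDy^[α.2] U)

/-- `∂̄ = (∂_x + i ∂_y) / 2` on `𝓖̃(A)`. -/
noncomputable def dbar {A : Set GenC} (U : Gen A) : Gen A :=
  (1 / 2 : ℂ) • (genDx U + Complex.I • genDy U)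

/-- `𝓖̃_H(A)`: the `U ∈ 𝓖̃(A)` with `∂̄U = 0` in `𝓖̃(A)`. -/
def GenH (A : Set GenC) : Set (Gen A) := {U | dbar U = 0}

/-! ### Point values -/

/-- The net `(u_ε(x_ε))_ε` as a moderate net, for a representative `(x_ε)_ε` of a point of `A`. -/
def evalNet {A : Set GenC} (u : EModerate A) (x : moderate) (hx : toGenC x ∈ A) : moderate :=
  ⟨fun ε => u.1 ε ((x : Eps → ℂ) ε), u.2.2 (0, 0) x hx⟩

/-- A representative of a generalized number. -/
noncomputable def rep (z : GenC) : moderate := Quotient.out z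

lemma toGenC_rep (z : GenC) : toGenC (rep z) = z := Quotient.out_eq z

/-- The point value `U(z)`; by `pointValue_toGen` below it does not depend on representatives. -/
noncomputable def pointValue {A : Set GenC} (U : Gen A) (z : A) : GenC :=
  Quotient.liftOn' U
    (fun u => toGenC (evalNet u (rep z) ((toGenC_rep (z : GenC)).symm ▸ z.2))) (by
    intro u w huw
    have h := (Submodule.quotientRel_def _).1 huw
    refine toGenC_eq_iff.2 ?_
    exact h.2 (0, 0) (rep z) ((toGenC_rep (z : GenC)).symm ▸ z.2))

lemma evalNet_congr {A : Set GenC} (u : EModerate A) {x y : moderate} (hx : toGenC x ∈ A)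
    (hy : toGenC y ∈ A) (hxy : toGenC x = toGenC y) :
    toGenC (evalNet u x hx) = toGenC (evalNet u y hy) := by
  have hsm : ∀ ε, ContDiff ℝ ∞ (u.1 ε) := u.2.1
  have hmax : ∀ ε : Eps, ∃ p ∈ segment ℝ ((x : Eps → ℂ) ε) ((y : Eps → ℂ) ε),
      ∀ q ∈ segment ℝ ((x : Eps → ℂ) ε) ((y : Eps → ℂ) ε),
        ‖fderiv ℝ (u.1 ε) q‖ ≤ ‖fderiv ℝ (u.1 ε) p‖ := by
    intro ε
    have hc : IsCompact (segment ℝ ((x : Eps → ℂ) ε) ((y : Eps → ℂ) ε)) := by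
      rw [segment_eq_image_lineMap]
      exact isCompact_Icc.image (by fun_prop)
    exact hc.exists_isMaxOn ⟨_, left_mem_segment ℝ _ _⟩
      ((hsm ε).continuous_fderiv (by simp)).norm.continuousOn
  choose p hp hpmax using hmax
  have hneg : IsNegligible ((x : Eps → ℂ) - y) := toGenC_eq_iff.1 hxy
  have hpx : IsNegligible (p - (x : Eps → ℂ)) := by
    intro m
    filter_upwards [hneg m] with ε h
    refine le_trans ?_ h
    obtain ⟨t, ht, hpt⟩ := (segment_eq_image_lineMap ℝ ((x : Eps → ℂ) ε) _) ▸ hp ε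
    have h1 : (p - (x : Eps → ℂ)) ε = t • ((y : Eps → ℂ) ε - (x : Eps → ℂ) ε) := by
      rw [Pi.sub_apply, ← hpt, AffineMap.lineMap_apply]; simp
    rw [h1, norm_smul, Pi.sub_apply, norm_sub_rev ((x : Eps → ℂ) ε), Real.norm_of_nonneg ht.1]
    exact mul_le_of_le_one_left (norm_nonneg _) ht.2
  have hpmod : IsModerate p := by
    have := hpx.isModerate.add x.2
    simpa using this
  have hpA : toGenC ⟨p, hpmod⟩ ∈ A := by
    have : toGenC ⟨p, hpmod⟩ = toGenC x := toGenC_eq_iff.2 hpx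
    rw [this]; exact hx
  obtain ⟨N, hN⟩ := u.2.2 (1, 0) ⟨p, hpmod⟩ hpA
  obtain ⟨M, hM⟩ := u.2.2 (0, 1) ⟨p, hpmod⟩ hpA
  refine toGenC_eq_iff.2 (IsNegligible.of_le 2 (max N M) fun m => ?_)
  filter_upwards [hN, hM, hneg m] with ε h1 h2 h3
  have hε : 0 < (ε : ℝ) := ε.2.1
  have e1 : (ε : ℝ) ^ (-(N : ℤ)) ≤ (ε : ℝ) ^ (-((max N M : ℕ) : ℤ)) :=
    zpow_le_zpow_right_of_le_one₀ hε ε.2.2.le (by simp)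
  have e2 : (ε : ℝ) ^ (-(M : ℤ)) ≤ (ε : ℝ) ^ (-((max N M : ℕ) : ℤ)) :=
    zpow_le_zpow_right_of_le_one₀ hε ε.2.2.le (by simp)
  have h1' : ‖fderiv ℝ (u.1 ε) (p ε) 1‖ ≤ (ε : ℝ) ^ (-((max N M : ℕ) : ℤ)) := le_trans h1 e1
  have h2' : ‖fderiv ℝ (u.1 ε) (p ε) Complex.I‖ ≤ (ε : ℝ) ^ (-((max N M : ℕ) : ℤ)) :=
    le_trans h2 e2
  have hbound : ‖fderiv ℝ (u.1 ε) (p ε)‖ ≤ 2 * (ε : ℝ) ^ (-((max N M : ℕ) : ℤ)) := by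
    refine ContinuousLinearMap.opNorm_le_bound _ (by positivity) fun w => ?_
    have hw : w = w.re • (1 : ℂ) + w.im • Complex.I := by
      simp [Complex.re_add_im]
    calc ‖fderiv ℝ (u.1 ε) (p ε) w‖
        = ‖w.re • fderiv ℝ (u.1 ε) (p ε) 1 + w.im • fderiv ℝ (u.1 ε) (p ε) Complex.I‖ := by
          conv_lhs => rw [hw, map_add, map_smul, map_smul]
      _ ≤ |w.re| * ‖fderiv ℝ (u.1 ε) (p ε) 1‖ + |w.im| * ‖fderiv ℝ (u.1 ε) (p ε) Complex.I‖ := by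
          refine (norm_add_le _ _).trans ?_
          simp
      _ ≤ ‖w‖ * (ε : ℝ) ^ (-((max N M : ℕ) : ℤ)) + ‖w‖ * (ε : ℝ) ^ (-((max N M : ℕ) : ℤ)) := by
          gcongr
          · exact Complex.abs_re_le_norm w
          · exact Complex.abs_im_le_norm w
      _ = 2 * (ε : ℝ) ^ (-((max N M : ℕ) : ℤ)) * ‖w‖ := by ring
  have hmv := (convex_segment ((x : Eps → ℂ) ε) ((y : Eps → ℂ) ε)).norm_image_sub_le_of_norm_fderiv_le
    (𝕜 := ℝ) (fun q _ => (hsm ε).differentiable (by simp) q)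
    (fun q hq => (hpmax ε q hq).trans hbound) (right_mem_segment ℝ _ _) (left_mem_segment ℝ _ _)
  refine hmv.trans ?_
  gcongr
  exact h3

/-- The point value `U(z) = [(u_ε(x_ε))_ε]` may be computed with any representatives. -/
lemma pointValue_toGen {A : Set GenC} (u : EModerate A) (x : moderate) (hx : toGenC x ∈ A) :
    pointValue (toGen u) ⟨toGenC x, hx⟩ = toGenC (evalNet u x hx) :=
  evalNet_congr u _ hx (toGenC_rep _)

/-! ### The conditions -/

/-- `limsup_{|α| → ∞} ‖∂^α U(z)‖♯^{1/|α|} ≤ c` for every `z ∈ A`, the upper limit being taken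
in `[0, ∞]`. -/
def RootBound {A : Set GenC} (U : Gen A) (c : ℝ) : Prop :=
  ∀ z : A, limsup
    (fun α : ℕ × ℕ => ENNReal.ofReal
      (sharpNorm (pointValue (genPartial α U) z) ^ (1 / ((α.1 + α.2 : ℕ) : ℝ))))
    (comap (fun α : ℕ × ℕ => α.1 + α.2) atTop) ≤ ENNReal.ofReal c

/-- `∂̄U` vanishes at `z` together with all its partial derivatives, that is, `∂̄U = 0` in
`𝓖̃({z})`. -/
def DbarVanishesAt {A : Set GenC} (U : Gen A) (z : A) : Prop :=
  ∀ α : ℕ × ℕ, pointValue (genPartial α (dbar U)) z = 0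

/-- The map `u` on `A` is given at each point by a power series about `z₀` with coefficients
in `ℂ̃`, converging for the sharp topology. -/
def IsPowerSeriesSum {A : Set GenC} (u : A → GenC) (z₀ : GenC) : Prop :=
  ∃ a : ℕ → GenC, ∀ z : A, SharpHasSum (fun n => a n * ((z : GenC) - z₀) ^ n) (u z)

/-- `U` has a representative `(p_ε)_ε` with all `p_ε ∈ ℂ[z]`. -/
def HasPolynomialRep {A : Set GenC} (U : Gen A) : Prop :=
  ∃ u : EModerate A, toGen u = U ∧
    ∀ ε : Eps, ∃ p : Polynomial ℂ, ∀ z : ℂ, (u : Eps → ℂ → ℂ) ε z = p.eval z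

end Colombeau

namespace Colombeau

/-! ### Power bounds for nets -/

/-! With s = -log r, a net represents a point of the ball exactly when its distance to x₀ is at most
ε^b for small ε, for some b > s (`mem_sharpBall_iff`). Every net within ε^b of x₀ is therefore a
legitimate point. Evaluating at points where |u_ε| or a derivative is maximal on the Euclidean ball
of radius ε^b turns pointwise asymptotic bounds into uniform ones (`uniform_powBound`,
`uniform_isModerate`).

(1) ⇒ (2) is Cauchy's estimate on circles of radius ε^b (`powBound_partialDeriv`): order-n
derivatives are bounded by ε^(N - nb), up to constants depending on n, with N independent of n. The
n-th root removes N, and b may tend to s. Since u_ε is only holomorphic up to a negligible defect,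
Cauchy's theorem is applied on an annulus whose inner radius ε^K is so small that Taylor's formula
controls u_ε there (`norm_taylorCoeff_le`).

(2) ⇒ (3) is Taylor's formula at x₀. The Cauchy-Riemann equations at x₀ alone make the Taylor
polynomial one in z up to negligible terms. A diagonal choice of points (`exists_net_frequently`)
makes the root bound uniform: for s < c < b, order-n derivatives are at most ε^(-nc) on the ball of
radius ε^b once n is large, so the remainder is of size ε^(n(b - c)).

(3) ⇒ (4): convergence at x₀ + ε^b bounds the coefficients. They are changed, without changing their
classes, so that the bounds hold for all ε at once (`exists_uniform_coeff`); truncation at degree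
⌊1/ε⌋ then has the sum of the series as point values. Point values determine a generalized function
on the ball (`pointValue_injective`), so this polynomial net represents u.

(4) ⇒ (1) holds because polynomials satisfy the Cauchy-Riemann equations exactly. -/

lemma Eps.pos (ε : Eps) : 0 < (ε : ℝ) := ε.2.1

lemma Eps.le_one (ε : Eps) : (ε : ℝ) ≤ 1 := ε.2.2.le

instance : Nonempty Eps := ⟨⟨1 / 2, by norm_num, by norm_num⟩⟩

/-- `|x_ε| ≤ ε^b` for small `ε`. -/
def PowBound (b : ℝ) (x : Eps → ℂ) : Prop :=
  ∀ᶠ ε : Eps in atBot, ‖x ε‖ ≤ (ε : ℝ) ^ b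

lemma eps_rpow_le {b c : ℝ} (h : c ≤ b) (ε : Eps) : (ε : ℝ) ^ b ≤ (ε : ℝ) ^ c :=
  Real.rpow_le_rpow_of_exponent_ge ε.pos ε.le_one h

/-- A constant factor is absorbed by an arbitrarily small loss in the exponent. -/
lemma eventually_const_mul_rpow_le (C : ℝ) {b c : ℝ} (h : c < b) :
    ∀ᶠ ε : Eps in atBot, C * (ε : ℝ) ^ b ≤ (ε : ℝ) ^ c := by
  have hp : 0 < ((|C| + 1)⁻¹) ^ (1 / (b - c)) := by positivity
  filter_upwards [eventually_lt hp] with ε h3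
  have hε := ε.pos
  have hbc := sub_pos.2 h
  have e2 : (ε : ℝ) ^ (b - c) ≤ (|C| + 1)⁻¹ := by
    have := Real.rpow_le_rpow hε.le h3.le hbc.le
    rwa [← Real.rpow_mul (by positivity), one_div_mul_cancel hbc.ne', Real.rpow_one] at this
  have e3 : (ε : ℝ) ^ b = (ε : ℝ) ^ (b - c) * (ε : ℝ) ^ c := by
    rw [← Real.rpow_add hε]; congr 1; ring
  rw [e3, ← mul_assoc]
  refine mul_le_of_le_one_left (by positivity) ?_
  calc C * (ε : ℝ) ^ (b - c) ≤ (|C| + 1) * (|C| + 1)⁻¹ := by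
        gcongr
        linarith [le_abs_self C]
    _ = 1 := mul_inv_cancel₀ (by positivity)

lemma PowBound.mono {b c : ℝ} {x : Eps → ℂ} (hx : PowBound b x) (h : c ≤ b) : PowBound c x := by
  filter_upwards [hx] with ε h1 using h1.trans (eps_rpow_le h ε)

lemma PowBound.of_le (C : ℝ) {b c : ℝ} {x : Eps → ℂ} (h : c < b)
    (hx : ∀ᶠ ε : Eps in atBot, ‖x ε‖ ≤ C * (ε : ℝ) ^ b) : PowBound c x := by
  filter_upwards [hx, eventually_const_mul_rpow_le C h] with ε h1 h2 using h1.trans h2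

/-- The factor 2 from the triangle inequality is paid for by the strict loss c < b; the same device
explains the exponents m + 1, N - 1, T + 1 below. -/
lemma PowBound.add {b c : ℝ} {x y : Eps → ℂ} (hx : PowBound b x) (hy : PowBound b y)
    (h : c < b) : PowBound c (x + y) := by
  refine PowBound.of_le 2 h ?_
  filter_upwards [hx, hy] with ε h1 h2
  have := norm_add_le (x ε) (y ε)
  simp only [Pi.add_apply]
  linarith

lemma PowBound.neg {b : ℝ} {x : Eps → ℂ} (hx : PowBound b x) : PowBound b (-x) := by
  simpa [PowBound] using hx

lemma isModerate_iff {x : Eps → ℂ} : IsModerate x ↔ ∃ b, PowBound b x := by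
  constructor
  · rintro ⟨N, hN⟩
    refine ⟨-N, ?_⟩
    filter_upwards [hN] with ε h
    rwa [← Real.rpow_intCast, Int.cast_neg, Int.cast_natCast] at h
  · rintro ⟨b, hb⟩
    obtain ⟨N, hN⟩ := exists_nat_ge (-b)
    refine ⟨N, ?_⟩
    filter_upwards [hb.mono (c := -N) (by linarith)] with ε h
    rwa [← Real.rpow_intCast, Int.cast_neg, Int.cast_natCast]

lemma isNegligible_iff {x : Eps → ℂ} : IsNegligible x ↔ ∀ b, PowBound b x := by
  constructor
  · intro h b
    obtain ⟨N, hN⟩ := exists_nat_ge b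
    refine PowBound.mono (b := N) ?_ hN
    filter_upwards [h N] with ε h
    rwa [Real.rpow_natCast]
  · intro h m
    filter_upwards [h m] with ε h
    rwa [← Real.rpow_natCast]

lemma IsNegligible.powBound {x : Eps → ℂ} (h : IsNegligible x) (b : ℝ) : PowBound b x :=
  isNegligible_iff.1 h b

lemma PowBound.isModerate {b : ℝ} {x : Eps → ℂ} (h : PowBound b x) : IsModerate x :=
  isModerate_iff.2 ⟨b, h⟩

lemma toGenC_surjective (z : GenC) : ∃ x, toGenC x = z := ⟨rep z, toGenC_rep z⟩

/-! ### The sharp norm in terms of power bounds -/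

lemma valuation_toGenC (x : moderate) : valuation (toGenC x) = netValuation (x : Eps → ℂ) := rfl

lemma PowBound.le_netValuation {b : ℝ} {x : Eps → ℂ} (h : PowBound b x) :
    (b : EReal) ≤ netValuation x :=
  le_iSup₂ (f := fun (b : ℝ) (_ : b ∈ {b : ℝ | ∀ᶠ ε : Eps in atBot,
    ‖x ε‖ ≤ (ε : ℝ) ^ b}) => (b : EReal)) b h

lemma powBound_of_lt_netValuation {b : ℝ} {x : Eps → ℂ} (h : (b : EReal) < netValuation x) :
    ∃ c, b < c ∧ PowBound c x := by
  obtain ⟨c, hc⟩ := lt_iSup_iff.1 h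
  obtain ⟨h1, h2⟩ := lt_iSup_iff.1 hc
  exact ⟨c, by exact_mod_cast h2, h1⟩

lemma sharpNorm_lt_exp_iff {b : ℝ} {x : moderate} :
    sharpNorm (toGenC x) < Real.exp (-b) ↔ (b : EReal) < netValuation (x : Eps → ℂ) := by
  -- Moderateness excludes valuation -∞, so `toReal` in `sharpNorm` never meets its default value at
  -- ⊤.
  have hbot : EReal.exp (-valuation (toGenC x)) ≠ ⊤ := by
    obtain ⟨c, hc⟩ := isModerate_iff.1 x.2
    have := hc.le_netValuation
    rw [valuation_toGenC]
    intro h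
    rw [EReal.exp_eq_top_iff, EReal.neg_eq_top_iff] at h
    rw [h] at this
    exact EReal.coe_ne_bot c (le_bot_iff.1 this)
  have h1 : ENNReal.ofReal (Real.exp (-b)) = EReal.exp (-(b : EReal)) := by
    rw [← EReal.coe_neg, EReal.exp_coe]
  rw [sharpNorm, ← ENNReal.lt_ofReal_iff_toReal_lt hbot, h1, EReal.exp_lt_exp_iff,
    EReal.neg_lt_neg_iff, valuation_toGenC]

lemma sharpNorm_nonneg (z : GenC) : 0 ≤ sharpNorm z := ENNReal.toReal_nonneg

lemma PowBound.sharpNorm_lt {b c : ℝ} {x : moderate} (h : PowBound b (x : Eps → ℂ)) (hc : c < b) :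
    sharpNorm (toGenC x) < Real.exp (-c) :=
  sharpNorm_lt_exp_iff.2 (lt_of_lt_of_le (by exact_mod_cast hc) h.le_netValuation)

lemma exists_powBound_of_sharpNorm_lt {c : ℝ} {x : moderate}
    (h : sharpNorm (toGenC x) < Real.exp (-c)) : ∃ b, c < b ∧ PowBound b (x : Eps → ℂ) :=
  powBound_of_lt_netValuation (sharpNorm_lt_exp_iff.1 h)

lemma tendsto_sharpNorm_iff {x : ℕ → moderate} :
    Tendsto (fun n => sharpNorm (toGenC (x n))) atTop (𝓝 0) ↔
      ∀ b : ℝ, ∀ᶠ n in atTop, PowBound b (x n : Eps → ℂ) := by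
  constructor
  · intro h b
    filter_upwards [h.eventually (gt_mem_nhds (Real.exp_pos (-b)))] with n hn
    obtain ⟨c, hc, h⟩ := exists_powBound_of_sharpNorm_lt hn
    exact h.mono hc.le
  · intro h
    rw [Metric.tendsto_nhds]
    intro e he
    filter_upwards [h (-Real.log e + 1)] with n hn
    rw [Real.dist_0_eq_abs, abs_of_nonneg (sharpNorm_nonneg _)]
    simpa [Real.exp_log he] using hn.sharpNorm_lt (c := -Real.log e) (by linarith)

lemma toGenC_sub (x y : moderate) : toGenC x - toGenC y = toGenC (x - y) := rfl

lemma mem_sharpBall_iff {r : ℝ} (hr : 0 < r) {x x₀ : moderate} :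
    toGenC x ∈ sharpBall (toGenC x₀) r ↔
      ∃ b, -Real.log r < b ∧ PowBound b ((x : Eps → ℂ) - x₀) := by
  have hr' : r = Real.exp (-(-Real.log r)) := by simp [Real.exp_log hr]
  change sharpNorm (toGenC x - toGenC x₀) < r ↔ _
  rw [toGenC_sub]
  constructor
  · intro h
    rw [hr'] at h
    exact exists_powBound_of_sharpNorm_lt h
  · rintro ⟨b, hb, h⟩
    rw [hr']
    exact PowBound.sharpNorm_lt (x := x - x₀) h hb

/-! ### Derivatives on representatives -/

section representatives

variable {A : Set GenC}

lemma toGen_surjective (U : Gen A) : ∃ u, toGen u = U := Submodule.Quotient.mk_surjective _ U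

lemma toGen_eq_iff {u w : EModerate A} :
    toGen u = toGen w ↔ (u : Eps → ℂ → ℂ) - w ∈ ENegligible A :=
  (Submodule.Quotient.eq _).trans Iff.rfl

lemma EModerate.smooth (u : EModerate A) (ε : Eps) : ContDiff ℝ ∞ ((u : Eps → ℂ → ℂ) ε) :=
  u.2.1 ε

lemma partialDeriv_smooth (α : ℕ × ℕ) {f : ℂ → ℂ} (hf : ContDiff ℝ ∞ f) :
    ContDiff ℝ ∞ (partialDeriv α f) :=
  dirDeriv_iter_smooth _ _ (dirDeriv_iter_smooth _ _ hf)

/-- `∂_x` on representatives. -/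
noncomputable def netDx (u : EModerate A) : EModerate A :=
  netDeriv A 1 (fun α => (α.1 + 1, α.2)) (fun α _ hf => partialDeriv_dx α hf) u

/-- `∂_y` on representatives. -/
noncomputable def netDy (u : EModerate A) : EModerate A :=
  netDeriv A Complex.I (fun α => (α.1, α.2 + 1)) (fun α f _ => partialDeriv_dy α f) u

/-- `∂^α` on representatives. -/
noncomputable def netPartial (α : ℕ × ℕ) (u : EModerate A) : EModerate A :=
  netDx^[α.1] (netDy^[α.2] u)

lemma netPartial_apply (α : ℕ × ℕ) (u : EModerate A) (ε : Eps) :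
    (netPartial α u : Eps → ℂ → ℂ) ε = partialDeriv α ((u : Eps → ℂ → ℂ) ε) := by
  have hy : ∀ n, (netDy^[n] u : Eps → ℂ → ℂ) ε
      = (dirDeriv Complex.I)^[n] ((u : Eps → ℂ → ℂ) ε) := by
    intro n
    induction n with
    | zero => rfl
    | succ n ih => rw [Function.iterate_succ_apply', Function.iterate_succ_apply', ← ih]; rfl
  have hx : ∀ (n : ℕ) (w : EModerate A), (netDx^[n] w : Eps → ℂ → ℂ) ε
      = (dirDeriv 1)^[n] ((w : Eps → ℂ → ℂ) ε) := by
    intro n w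
    induction n with
    | zero => rfl
    | succ n ih => rw [Function.iterate_succ_apply', Function.iterate_succ_apply', ← ih]; rfl
  rw [netPartial, hx, hy]; rfl

lemma genPartial_toGen (α : ℕ × ℕ) (u : EModerate A) :
    genPartial α (toGen u) = toGen (netPartial α u) := by
  have hy : ∀ n, genDy^[n] (toGen u) = toGen (netDy^[n] u) := by
    intro n
    induction n with
    | zero => rfl
    | succ n ih => rw [Function.iterate_succ_apply', Function.iterate_succ_apply', ih]; rfl
  have hx : ∀ (n : ℕ) (w : EModerate A), genDx^[n] (toGen w) = toGen (netDx^[n] w) := by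
    intro n w
    induction n with
    | zero => rfl
    | succ n ih => rw [Function.iterate_succ_apply', Function.iterate_succ_apply', ih]; rfl
  rw [genPartial, hy, hx]; rfl

/-- `∂̄` on representatives. -/
noncomputable def netDbar (u : EModerate A) : EModerate A :=
  (1 / 2 : ℂ) • (netDx u + Complex.I • netDy u)

lemma dbar_toGen (u : EModerate A) : dbar (toGen u) = toGen (netDbar u) := rfl

/-- Since (∂_x + i∂_y)/2 = (i/2)(∂_y - i∂_x), the defect takes the form of the rule ∂_y = i∂_x,
which is how it is used later. -/
lemma partialDeriv_netDbar (α : ℕ × ℕ) (u : EModerate A) (ε : Eps) :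
    partialDeriv α ((netDbar u : Eps → ℂ → ℂ) ε) = (Complex.I / 2) •
      (partialDeriv (α.1, α.2 + 1) ((u : Eps → ℂ → ℂ) ε)
        - Complex.I • partialDeriv (α.1 + 1, α.2) ((u : Eps → ℂ → ℂ) ε)) := by
  have hs := EModerate.smooth u ε
  have h : (netDbar u : Eps → ℂ → ℂ) ε = (1 / 2 : ℂ) • (dirDeriv 1 ((u : Eps → ℂ → ℂ) ε)
    + Complex.I • dirDeriv Complex.I ((u : Eps → ℂ → ℂ) ε)) := rfl
  have h1 := dirDeriv_smooth 1 hs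
  have h2 := dirDeriv_smooth Complex.I hs
  have h3 : ContDiff ℝ ∞ (Complex.I • dirDeriv Complex.I ((u : Eps → ℂ → ℂ) ε)) :=
    h2.const_smul Complex.I
  have h4 : ContDiff ℝ ∞ (dirDeriv 1 ((u : Eps → ℂ → ℂ) ε)
    + Complex.I • dirDeriv Complex.I ((u : Eps → ℂ → ℂ) ε)) := h1.add h3
  rw [h, partialDeriv_smul _ _ h4, partialDeriv_add _ h1 h3, partialDeriv_smul _ _ h2,
    partialDeriv_dx _ hs, partialDeriv_dy]
  ext z
  simp only [Pi.smul_apply, Pi.add_apply, Pi.sub_apply, smul_eq_mul]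
  linear_combination ((1 / 2) * partialDeriv (α.1 + 1, α.2) ((u : Eps → ℂ → ℂ) ε) z) *
    Complex.I_sq

/-- All partial derivatives of `∂_y u - i ∂_x u` are negligible along the net `x`. -/
def CRNegligibleAt (u : Eps → ℂ → ℂ) (x : Eps → ℂ) : Prop :=
  ∀ i j : ℕ, IsNegligible fun ε => partialDeriv (i, j + 1) (u ε) (x ε)
    - Complex.I * partialDeriv (i + 1, j) (u ε) (x ε)

lemma isNegligible_const_mul_iff {c : ℂ} (hc : c ≠ 0) {x : Eps → ℂ} :
    IsNegligible (fun ε => c * x ε) ↔ IsNegligible x := by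
  refine ⟨fun h => ?_, fun h => IsNegligible.moderate_mul (IsModerate.const c) h⟩
  have := IsNegligible.moderate_mul (IsModerate.const c⁻¹) h
  convert this using 1
  ext ε
  simp [hc]

lemma crNegligibleAt_iff (u : EModerate A) (x : Eps → ℂ) :
    CRNegligibleAt u x ↔ ∀ α, IsNegligible fun ε =>
      partialDeriv α ((netDbar u : Eps → ℂ → ℂ) ε) (x ε) := by
  have hI : Complex.I / 2 ≠ 0 := by simp
  simp only [partialDeriv_netDbar, Pi.smul_apply, Pi.sub_apply, smul_eq_mul,
    isNegligible_const_mul_iff hI, CRNegligibleAt, Prod.forall]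

lemma toGen_mem_GenH_iff (u : EModerate A) :
    toGen u ∈ GenH A ↔ ∀ x : moderate, toGenC x ∈ A → CRNegligibleAt u x := by
  have h0 : (0 : Gen A) = toGen 0 := rfl
  change dbar (toGen u) = 0 ↔ _
  rw [dbar_toGen, h0, toGen_eq_iff]
  simp only [crNegligibleAt_iff]
  constructor
  · intro h x hx α
    simpa using h.2 α x hx
  · intro h
    refine ⟨fun ε => ?_, fun α x hx => ?_⟩
    · simpa using EModerate.smooth (netDbar u) ε
    · simpa using h x hx α

lemma pointValue_genPartial (α : ℕ × ℕ) (u : EModerate A) (x : moderate) (hx : toGenC x ∈ A) :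
    pointValue (genPartial α (toGen u)) ⟨toGenC x, hx⟩ =
      toGenC ⟨fun ε => partialDeriv α ((u : Eps → ℂ → ℂ) ε) ((x : Eps → ℂ) ε), u.2.2 α x hx⟩ := by
  rw [genPartial_toGen, pointValue_toGen]
  congr 1
  ext ε
  exact congrFun (netPartial_apply α u ε) _

lemma dbarVanishesAt_iff (u : EModerate A) (x : moderate) (hx : toGenC x ∈ A) :
    DbarVanishesAt (toGen u) ⟨toGenC x, hx⟩ ↔ CRNegligibleAt u x := by
  rw [crNegligibleAt_iff, DbarVanishesAt]
  refine forall_congr' fun α => ?_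
  rw [dbar_toGen, pointValue_genPartial]
  change _ = toGenC 0 ↔ _
  rw [toGenC_eq_iff]
  simp

end representatives

/-! ### Taylor expansion of a smooth function on `ℂ` -/

lemma dirDeriv_eq (w : ℂ) (f : ℂ → ℂ) :
    dirDeriv w f = (w.re : ℂ) • dirDeriv 1 f + (w.im : ℂ) • dirDeriv Complex.I f := by
  ext z
  have hw : w = w.re • (1 : ℂ) + w.im • Complex.I := by simp [Complex.re_add_im]
  simp only [dirDeriv, Pi.add_apply, Pi.smul_apply]
  conv_lhs => rw [hw, map_add, map_smul, map_smul]
  simp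

/-- If the partial derivatives of order `k` at `z` are close to those of a holomorphic function
with `k`-th derivative `c`, then so is the `k`-th derivative in each direction. -/
lemma norm_dirDeriv_iter_sub_le {f : ℂ → ℂ} (hf : ContDiff ℝ ∞ f) (w z c : ℂ) (k : ℕ) {δ : ℝ}
    (h : ∀ i j, i + j = k → ‖partialDeriv (i, j) f z - Complex.I ^ j * c‖ ≤ δ) :
    ‖(dirDeriv w)^[k] f z - w ^ k * c‖ ≤ (2 * ‖w‖) ^ k * δ := by
  induction k generalizing f c with
  | zero => simpa [partialDeriv] using h 0 0 rfl
  | succ k ih =>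
    have h1 := dirDeriv_smooth 1 hf
    have h2 := dirDeriv_smooth Complex.I hf
    have b1 := ih h1 c fun i j hij => by
      rw [partialDeriv_dx _ hf]; exact h (i + 1) j (by omega)
    have b2 := ih h2 (Complex.I * c) fun i j hij => by
      rw [partialDeriv_dy]
      have := h i (j + 1) (by omega)
      rwa [pow_succ, mul_assoc] at this
    have h3 : ContDiff ℝ ∞ ((w.re : ℂ) • dirDeriv 1 f) := h1.const_smul (w.re : ℂ)
    have h4 : ContDiff ℝ ∞ ((w.im : ℂ) • dirDeriv Complex.I f) := h2.const_smul (w.im : ℂ)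
    -- Peel off one derivative along w = Re w + i Im w. The ∂_y part has model derivative i·c, and
    -- the two parts each cost a factor ‖w‖, whence 2‖w‖ per order.
    have e : (dirDeriv w)^[k + 1] f z - w ^ (k + 1) * c
        = w.re * ((dirDeriv w)^[k] (dirDeriv 1 f) z - w ^ k * c)
          + w.im * ((dirDeriv w)^[k] (dirDeriv Complex.I f) z - w ^ k * (Complex.I * c)) := by
      rw [Function.iterate_succ_apply, dirDeriv_eq w f,
        dirDeriv_iter_add _ _ h3 h4,
        dirDeriv_iter_smul _ _ _ h1, dirDeriv_iter_smul _ _ _ h2]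
      simp only [Pi.add_apply, Pi.smul_apply, smul_eq_mul]
      linear_combination (-(w ^ k * c)) * (Complex.re_add_im w).symm
    rw [e]
    have hδ : 0 ≤ (2 * ‖w‖) ^ k * δ := (norm_nonneg _).trans b1
    calc _ ≤ ‖w‖ * ((2 * ‖w‖) ^ k * δ) + ‖w‖ * ((2 * ‖w‖) ^ k * δ) := by
          refine (norm_add_le _ _).trans ?_
          rw [norm_mul, norm_mul, Complex.norm_real, Complex.norm_real]
          gcongr
          · exact Complex.abs_re_le_norm w
          · exact Complex.abs_im_le_norm w
      _ = (2 * ‖w‖) ^ (k + 1) * δ := by ring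

lemma norm_dirDeriv_iter_le {f : ℂ → ℂ} (hf : ContDiff ℝ ∞ f) (w z : ℂ) (k : ℕ) {M : ℝ}
    (h : ∀ i j, i + j = k → ‖partialDeriv (i, j) f z‖ ≤ M) :
    ‖(dirDeriv w)^[k] f z‖ ≤ (2 * ‖w‖) ^ k * M := by
  simpa using norm_dirDeriv_iter_sub_le hf w z 0 k (by simpa using h)

lemma iteratedDeriv_along_line {f : ℂ → ℂ} (hf : ContDiff ℝ ∞ f) (z w : ℂ) (k : ℕ) :
    iteratedDeriv k (fun t : ℝ => f (z + t * w)) = fun t : ℝ => (dirDeriv w)^[k] f (z + t * w) := by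
  induction k with
  | zero => simp
  | succ k ih =>
    rw [iteratedDeriv_succ, ih, Function.iterate_succ_apply']
    funext t
    have h1 : HasDerivAt (fun t : ℝ => z + t * w) w t := by
      simpa using ((Complex.ofRealCLM.hasDerivAt (x := t)).mul_const w).const_add z
    have h2 := (((dirDeriv_iter_smooth w k hf).differentiable (by simp)) (z + t * w)).hasFDerivAt
    exact (h2.comp_hasDerivAt t h1).deriv

/-- Taylor's formula along the segment from `z` to `z + w`. -/
lemma norm_sub_taylor_le {f : ℂ → ℂ} (hf : ContDiff ℝ ∞ f) (z w : ℂ) (n : ℕ) {C : ℝ}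
    (h : ∀ t : ℝ, t ∈ Set.Icc (0 : ℝ) 1 → ‖(dirDeriv w)^[n + 1] f (z + t * w)‖ ≤ C) :
    ‖f (z + w) - ∑ k ∈ Finset.range (n + 1), (dirDeriv w)^[k] f z / k.factorial‖
      ≤ C / n.factorial := by
  have hφ : ContDiff ℝ ∞ (fun t : ℝ => f (z + t * w)) :=
    hf.comp (contDiff_const.add (Complex.ofRealCLM.contDiff.mul contDiff_const))
  have hw : ∀ k : ℕ, ∀ t ∈ Set.Icc (0 : ℝ) 1,
      iteratedDerivWithin k (fun t : ℝ => f (z + t * w)) (Set.Icc 0 1) t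
        = (dirDeriv w)^[k] f (z + t * w) := by
    intro k t ht
    rw [iteratedDerivWithin_eq_iteratedDeriv (uniqueDiffOn_Icc zero_lt_one)
      (hφ.contDiffAt.of_le (by exact_mod_cast le_top)) ht, iteratedDeriv_along_line hf]
  have := taylor_mean_remainder_bound (f := fun t : ℝ => f (z + t * w)) (n := n) zero_le_one
    (hφ.of_le (by exact_mod_cast le_top)).contDiffOn (Set.right_mem_Icc.2 zero_le_one)
    (fun t ht => by rw [hw _ t ht]; exact h t ht)
  rw [taylor_within_apply] at this
  simp only [Complex.ofReal_one, one_mul, sub_zero, one_pow, mul_one] at this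
  refine (le_of_eq ?_).trans this
  congr 2
  refine Finset.sum_congr rfl fun k _ => ?_
  rw [hw k 0 (Set.left_mem_Icc.2 zero_le_one)]
  simp [div_eq_inv_mul]

/-- Complex Taylor formula for a function which almost satisfies the Cauchy-Riemann equations
at `z`. -/
lemma norm_sub_complex_taylor_le {f : ℂ → ℂ} (hf : ContDiff ℝ ∞ f) (z w : ℂ) (n : ℕ) (c : ℕ → ℂ)
    {δ M : ℝ} (hδ : ∀ k ≤ n, ∀ i j, i + j = k →
      ‖partialDeriv (i, j) f z - Complex.I ^ j * c k‖ ≤ δ)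
    (hM : ∀ t : ℝ, t ∈ Set.Icc (0 : ℝ) 1 → ∀ i j, i + j = n + 1 →
      ‖partialDeriv (i, j) f (z + t * w)‖ ≤ M) :
    ‖f (z + w) - ∑ k ∈ Finset.range (n + 1), c k / k.factorial * w ^ k‖
      ≤ (∑ k ∈ Finset.range (n + 1), (2 * ‖w‖) ^ k) * δ + (2 * ‖w‖) ^ (n + 1) * M := by
  have h0 : 0 ≤ (2 * ‖w‖) ^ (n + 1) * M := (norm_nonneg _).trans
    (norm_dirDeriv_iter_le hf w _ _ (hM 0 (Set.left_mem_Icc.2 zero_le_one)))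
  have h1 := norm_sub_taylor_le hf z w n fun t ht =>
    norm_dirDeriv_iter_le hf w _ _ (hM t ht)
  have h2 : ‖∑ k ∈ Finset.range (n + 1), (dirDeriv w)^[k] f z / k.factorial
      - ∑ k ∈ Finset.range (n + 1), c k / k.factorial * w ^ k‖
      ≤ (∑ k ∈ Finset.range (n + 1), (2 * ‖w‖) ^ k) * δ := by
    rw [← Finset.sum_sub_distrib, Finset.sum_mul]
    refine norm_sum_le_of_le _ fun k hk => ?_
    have e : (dirDeriv w)^[k] f z / k.factorial - c k / k.factorial * w ^ k
        = ((dirDeriv w)^[k] f z - w ^ k * c k) / k.factorial := by ring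
    have hk' : (1 : ℝ) ≤ k.factorial := by exact_mod_cast k.factorial_pos
    rw [e, norm_div, Complex.norm_natCast]
    exact (div_le_self (norm_nonneg _) hk').trans (norm_dirDeriv_iter_sub_le hf w z (c k) k
      (hδ k (Nat.lt_succ_iff.1 (Finset.mem_range.1 hk))))
  have hn : (1 : ℝ) ≤ n.factorial := by exact_mod_cast n.factorial_pos
  have h3 := norm_add_le_of_le h1 h2
  rw [sub_add_sub_cancel] at h3
  linarith [div_le_self h0 hn]

/-! ### Cauchy's estimate for almost holomorphic functions -/

/-- The integrand `f(z + e^ζ) e^{-nζ}` of Cauchy's formula, in the logarithmic coordinate. -/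
noncomputable def logIntegrand (f : ℂ → ℂ) (z : ℂ) (n : ℕ) (ζ : ℂ) : ℂ :=
  f (z + Complex.exp ζ) * Complex.exp (-n * ζ)

lemma logIntegrand_smooth {f : ℂ → ℂ} (hf : ContDiff ℝ ∞ f) (z : ℂ) (n : ℕ) :
    ContDiff ℝ ∞ (logIntegrand f z n) := by
  have he : ContDiff ℝ ∞ Complex.exp := Complex.contDiff_exp
  exact (hf.comp (contDiff_const.add he)).mul (he.comp (contDiff_const.mul contDiff_id))

lemma logIntegrand_periodic (f : ℂ → ℂ) (z : ℂ) (n : ℕ) (ζ : ℂ) :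
    logIntegrand f z n (ζ + 2 * Real.pi * Complex.I) = logIntegrand f z n ζ := by
  have h : Complex.exp (-n * (ζ + 2 * Real.pi * Complex.I)) = Complex.exp (-n * ζ) := by
    rw [mul_add, Complex.exp_add]
    have : Complex.exp (-n * (2 * Real.pi * Complex.I)) = 1 :=
      Complex.exp_eq_one_iff.2 ⟨-n, by push_cast; ring⟩
    rw [this, mul_one]
  rw [logIntegrand, h, Complex.exp_periodic ζ, logIntegrand]

/-- Both ζ ↦ z + e^ζ and ζ ↦ e^(-nζ) are holomorphic, so the terms containing f itself cancel and
the defect of f is merely multiplied by the conjugate of e^ζ and by e^(-nζ). -/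
lemma norm_dbar_logIntegrand {f : ℂ → ℂ} (hf : ContDiff ℝ ∞ f) (z : ℂ) (n : ℕ) (ζ : ℂ) :
    ‖Complex.I • fderiv ℝ (logIntegrand f z n) ζ 1 - fderiv ℝ (logIntegrand f z n) ζ Complex.I‖
      = Real.exp ζ.re * Real.exp (-n * ζ.re) *
        ‖dirDeriv Complex.I f (z + Complex.exp ζ)
          - Complex.I * dirDeriv 1 f (z + Complex.exp ζ)‖ := by
  set q := z + Complex.exp ζ
  have he : HasFDerivAt (fun ζ => z + Complex.exp ζ)
      ((ContinuousLinearMap.toSpanSingleton ℂ (Complex.exp ζ)).restrictScalars ℝ) ζ :=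
    (((Complex.hasDerivAt_exp ζ).const_add z).hasFDerivAt).restrictScalars ℝ
  have hE : HasFDerivAt (fun ζ => Complex.exp (-n * ζ))
      ((ContinuousLinearMap.toSpanSingleton ℂ
        (Complex.exp (-n * ζ) * (-n * 1))).restrictScalars ℝ) ζ :=
    ((((hasDerivAt_id ζ).const_mul (-n : ℂ)).cexp).hasFDerivAt).restrictScalars ℝ
  have hff : HasFDerivAt f (fderiv ℝ f q) q := (hf.differentiable (by simp) q).hasFDerivAt
  have hg := (hff.comp ζ he).mul hE
  have hg' : fderiv ℝ (logIntegrand f z n) ζ = _ := hg.fderiv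
  have hv : ∀ v, fderiv ℝ (logIntegrand f z n) ζ v
      = Complex.exp (-n * ζ) * dirDeriv (v * Complex.exp ζ) f q
        + f q * (v * (Complex.exp (-n * ζ) * -n)) := by
    intro v
    rw [hg']
    simp [dirDeriv, q]
    ring
  rw [hv, hv, dirDeriv_eq (1 * _), dirDeriv_eq (Complex.I * _)]
  set e := Complex.exp ζ with hedef
  have key : Complex.I • (Complex.exp (-n * ζ) *
        (((1 * e).re : ℂ) • dirDeriv 1 f + ((1 * e).im : ℂ) • dirDeriv Complex.I f) q
        + f q * (1 * (Complex.exp (-n * ζ) * -n)))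
      - (Complex.exp (-n * ζ) * (((Complex.I * e).re : ℂ) • dirDeriv 1 f
        + ((Complex.I * e).im : ℂ) • dirDeriv Complex.I f) q
        + f q * (Complex.I * (Complex.exp (-n * ζ) * -n)))
      = -(starRingEnd ℂ e) * Complex.exp (-n * ζ) *
        (dirDeriv Complex.I f q - Complex.I * dirDeriv 1 f q) := by
    have hc : starRingEnd ℂ e = e.re - e.im * Complex.I := by
      apply Complex.ext <;> simp
    rw [hc]
    simp only [Pi.add_apply, Pi.smul_apply, smul_eq_mul, one_mul, Complex.I_mul_re,
      Complex.I_mul_im, Complex.ofReal_neg]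
    linear_combination (e.im * Complex.exp (-n * ζ) * dirDeriv 1 f q) * Complex.I_sq
  rw [key, norm_mul, norm_mul, norm_neg, RCLike.norm_conj, hedef, Complex.norm_exp,
    Complex.norm_exp]
  simp

/-- Cauchy's theorem on an annulus for an almost holomorphic function. -/
lemma norm_integral_logIntegrand_sub_le {f : ℂ → ℂ} (hf : ContDiff ℝ ∞ f) (z : ℂ) (n : ℕ)
    {a b D : ℝ} (hab : a ≤ b)
    (hD : ∀ q, ‖q - z‖ ≤ Real.exp b →
      ‖dirDeriv Complex.I f q - Complex.I * dirDeriv 1 f q‖ ≤ D) :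
    ‖(∫ θ in (0 : ℝ)..2 * Real.pi, logIntegrand f z n (b + θ * Complex.I))
      - ∫ θ in (0 : ℝ)..2 * Real.pi, logIntegrand f z n (a + θ * Complex.I)‖
      ≤ (b - a) * (2 * Real.pi) * (Real.exp b * Real.exp (-n * a) * D) := by
  have hg := logIntegrand_smooth hf z n
  set g := logIntegrand f z n with hgdef
  have hcont : Continuous fun ζ => Complex.I • fderiv ℝ g ζ 1 - fderiv ℝ g ζ Complex.I := by
    have := hg.continuous_fderiv (by simp)
    fun_prop
  -- Green's formula on the rectangle [a, b] × [0, 2π], which the exponential wraps onto the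
  -- annulus; by periodicity the horizontal sides cancel.
  have hst := Complex.integral_boundary_rect_of_differentiableOn_real g a (b + 2 * Real.pi * Complex.I)
    (hg.differentiable (by simp)).differentiableOn
    (hcont.continuousOn.integrableOn_compact (isCompact_uIcc.reProdIm isCompact_uIcc))
  have hper : ∀ x : ℝ, g (x + 2 * Real.pi * Complex.I) = g x := fun x =>
    logIntegrand_periodic f z n x
  simp only [Complex.ofReal_re, Complex.ofReal_im, Complex.add_re, Complex.add_im, Complex.mul_re,
    Complex.mul_im, Complex.re_ofNat, Complex.im_ofNat, Complex.I_re, Complex.I_im, mul_zero,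
    zero_mul, mul_one, sub_zero, add_zero, zero_add, sub_self, Complex.ofReal_zero,
    Complex.ofReal_mul, Complex.ofReal_ofNat, hper, ← smul_sub] at hst
  have hn := congrArg norm hst
  rw [norm_smul, Complex.norm_I, one_mul] at hn
  rw [hn]
  have hπ : (0 : ℝ) ≤ 2 * Real.pi := by positivity
  have hin : ∀ x ∈ Set.uIoc a b, ‖∫ y in (0 : ℝ)..2 * Real.pi,
      (Complex.I • fderiv ℝ g (x + y * Complex.I) 1 - fderiv ℝ g (x + y * Complex.I) Complex.I)‖
      ≤ (Real.exp b * Real.exp (-n * a) * D) * |2 * Real.pi - 0| := by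
    intro x hx
    rw [Set.uIoc_of_le hab] at hx
    refine intervalIntegral.norm_integral_le_of_norm_le_const fun y _ => ?_
    rw [hgdef, norm_dbar_logIntegrand hf]
    have hre : ((x : ℂ) + y * Complex.I).re = x := by simp
    rw [hre]
    have hq : ‖z + Complex.exp (x + y * Complex.I) - z‖ ≤ Real.exp b := by
      rw [add_sub_cancel_left, Complex.norm_exp, hre]
      exact Real.exp_le_exp.2 hx.2
    have := hD _ hq
    have hx1 := hx.1.le
    have hx2 := hx.2
    have h3 : -(n : ℝ) * x ≤ -n * a := by
      rw [neg_mul, neg_mul, neg_le_neg_iff]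
      gcongr
    gcongr
  have := intervalIntegral.norm_integral_le_of_norm_le_const hin
  rw [abs_of_nonneg (sub_nonneg.2 hab), sub_zero, abs_of_nonneg hπ] at this
  linarith

lemma integral_exp_int_mul (a : ℝ) (m : ℤ) :
    ∫ θ in (0 : ℝ)..2 * Real.pi, Complex.exp (m * (a + θ * Complex.I))
      = if m = 0 then 2 * (Real.pi : ℂ) else 0 := by
  split_ifs with h
  · simp [h]
  · have h1 : ∀ θ : ℝ, Complex.exp (m * (a + θ * Complex.I))
        = Complex.exp (m * a) * Complex.exp (m * Complex.I * θ) := by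
      intro θ
      rw [← Complex.exp_add]
      ring_nf
    have h2 : (m : ℂ) * Complex.I ≠ 0 := by simp [h]
    simp only [h1]
    rw [intervalIntegral.integral_const_mul, integral_exp_mul_complex h2]
    have : Complex.exp (m * Complex.I * (2 * Real.pi : ℝ)) = 1 :=
      Complex.exp_eq_one_iff.2 ⟨m, by push_cast; ring⟩
    rw [this]
    simp

/-- Cauchy's estimate for an almost holomorphic function with given Taylor expansion. -/
lemma norm_taylorCoeff_le {f : ℂ → ℂ} (hf : ContDiff ℝ ∞ f) (z : ℂ) (n : ℕ) (c : ℕ → ℂ)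
    {ρ R S D E : ℝ} (hρ : 0 < ρ) (hR : ρ ≤ R)
    (hS : ∀ q, ‖q - z‖ ≤ R → ‖f q‖ ≤ S)
    (hD : ∀ q, ‖q - z‖ ≤ R → ‖dirDeriv Complex.I f q - Complex.I * dirDeriv 1 f q‖ ≤ D)
    (hE : ∀ w, ‖w‖ = ρ → ‖f (z + w) - ∑ k ∈ Finset.range (n + 1), c k * w ^ k‖ ≤ E) :
    ‖c n‖ ≤ S / R ^ n + (Real.log R - Real.log ρ) * R * D / ρ ^ n + E / ρ ^ n := by
  have hR0 : 0 < R := hρ.trans_le hR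
  have hexp : ∀ {x : ℝ}, 0 < x → Real.exp (-n * Real.log x) = 1 / x ^ n := by
    intro x hx
    rw [neg_mul, Real.exp_neg, Real.exp_nat_mul, Real.exp_log hx, one_div]
  have hnorm : ∀ {x : ℝ} (θ : ℝ), 0 < x →
      ‖Complex.exp (Real.log x + θ * Complex.I)‖ = x := by
    intro x θ hx
    rw [Complex.norm_exp]
    simp [Real.exp_log hx]
  have hnorm' : ∀ {x : ℝ} (θ : ℝ), 0 < x →
      ‖Complex.exp (-n * (Real.log x + θ * Complex.I))‖ = 1 / x ^ n := by
    intro x θ hx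
    rw [Complex.norm_exp, ← hexp hx]
    simp
  have hπ : (0 : ℝ) < 2 * Real.pi := by positivity
  have h1 := norm_integral_logIntegrand_sub_le hf z n (Real.log_le_log hρ hR) (D := D)
    (by rwa [Real.exp_log hR0])
  rw [Real.exp_log hR0, hexp hρ] at h1
  have h2 : ‖∫ θ in (0 : ℝ)..2 * Real.pi,
      logIntegrand f z n (Real.log R + θ * Complex.I)‖ ≤ S / R ^ n * (2 * Real.pi) := by
    have := intervalIntegral.norm_integral_le_of_norm_le_const (a := 0) (b := 2 * Real.pi)
      (f := fun θ : ℝ => logIntegrand f z n (Real.log R + θ * Complex.I)) (C := S / R ^ n)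
      fun θ _ => by
        rw [logIntegrand, norm_mul, hnorm' θ hR0, mul_one_div]
        gcongr
        exact hS _ (by rw [add_sub_cancel_left, hnorm θ hR0])
    rwa [sub_zero, abs_of_pos hπ] at this
  -- The Taylor polynomial times e^(-nζ) on the inner circle. By orthogonality of the exponentials
  -- its integral isolates c n.
  set T : ℝ → ℂ := fun θ => ∑ k ∈ Finset.range (n + 1),
    c k * Complex.exp (((k : ℤ) - n : ℤ) * (Real.log ρ + θ * Complex.I)) with hT
  have hTint : ∫ θ in (0 : ℝ)..2 * Real.pi, T θ = c n * (2 * Real.pi) := by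
    rw [hT, intervalIntegral.integral_finsetSum]
    · simp only [intervalIntegral.integral_const_mul, integral_exp_int_mul]
      rw [Finset.sum_eq_single n]
      · simp
      · intro k _ hk
        rw [if_neg (by omega), mul_zero]
      · simp
    · intro k _
      apply Continuous.intervalIntegrable
      fun_prop
  have hgc : Continuous fun θ : ℝ => logIntegrand f z n (Real.log ρ + θ * Complex.I) :=
    (logIntegrand_smooth hf z n).continuous.comp (by fun_prop)
  have hTc : Continuous T := by
    rw [hT]; fun_prop
  have h3 : ‖(∫ θ in (0 : ℝ)..2 * Real.pi, logIntegrand f z n (Real.log ρ + θ * Complex.I))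
      - c n * (2 * Real.pi)‖ ≤ E / ρ ^ n * (2 * Real.pi) := by
    rw [← hTint, ← intervalIntegral.integral_sub (hgc.intervalIntegrable _ _)
      (hTc.intervalIntegrable _ _)]
    have := intervalIntegral.norm_integral_le_of_norm_le_const (a := 0) (b := 2 * Real.pi)
      (f := fun θ : ℝ => logIntegrand f z n (Real.log ρ + θ * Complex.I) - T θ) (C := E / ρ ^ n)
      fun θ _ => by
        have e : logIntegrand f z n (Real.log ρ + θ * Complex.I) - T θ
            = (f (z + Complex.exp (Real.log ρ + θ * Complex.I))
              - ∑ k ∈ Finset.range (n + 1), c k * Complex.exp (Real.log ρ + θ * Complex.I) ^ k)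
              * Complex.exp (-n * (Real.log ρ + θ * Complex.I)) := by
          rw [logIntegrand, sub_mul, Finset.sum_mul, hT]
          congr 1
          refine Finset.sum_congr rfl fun k _ => ?_
          rw [mul_assoc, ← Complex.exp_nat_mul, ← Complex.exp_add]
          congr 2
          push_cast
          ring
        rw [e, norm_mul, hnorm' θ hρ, mul_one_div]
        gcongr
        exact hE _ (hnorm θ hρ)
    rwa [sub_zero, abs_of_pos hπ] at this
  have h4 : ‖c n * (2 * Real.pi)‖ = ‖c n‖ * (2 * Real.pi) := by
    rw [norm_mul, ← Complex.ofReal_ofNat, ← Complex.ofReal_mul, Complex.norm_real,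
      Real.norm_of_nonneg hπ.le]
  have h5 : ‖c n * (2 * Real.pi)‖ ≤ S / R ^ n * (2 * Real.pi)
      + (Real.log R - Real.log ρ) * (2 * Real.pi) * (R * (1 / ρ ^ n) * D)
      + E / ρ ^ n * (2 * Real.pi) := by
    set J1 := ∫ θ in (0 : ℝ)..2 * Real.pi, logIntegrand f z n (Real.log R + θ * Complex.I)
    set J2 := ∫ θ in (0 : ℝ)..2 * Real.pi, logIntegrand f z n (Real.log ρ + θ * Complex.I)
    -- The three terms are the outer circle, the defect on the annulus, and the Taylor error on the
    -- inner circle.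
    have e : c n * (2 * Real.pi) = J1 - (J1 - J2) - (J2 - c n * (2 * Real.pi)) := by ring
    rw [e]
    exact (norm_sub_le_of_le (norm_sub_le_of_le h2 h1) h3)
  rw [h4] at h5
  refine le_of_mul_le_mul_right (h5.trans_eq ?_) hπ
  ring

/-! ### Uniform bounds on balls -/

/-- The net of maximum points is itself a generalized point, so a bound along it is a bound on the
whole balls. -/
lemma exists_isMax_on_balls {g : Eps → ℂ → ℂ} (hg : ∀ ε, Continuous (g ε)) (x₀ : Eps → ℂ) (b : ℝ) :
    ∃ p : Eps → ℂ, (∀ ε, ‖p ε - x₀ ε‖ ≤ (ε : ℝ) ^ b) ∧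
      ∀ ε q, ‖q - x₀ ε‖ ≤ (ε : ℝ) ^ b → ‖g ε q‖ ≤ ‖g ε (p ε)‖ := by
  have h : ∀ ε : Eps, ∃ p ∈ Metric.closedBall (x₀ ε) ((ε : ℝ) ^ b),
      ∀ q ∈ Metric.closedBall (x₀ ε) ((ε : ℝ) ^ b), ‖g ε q‖ ≤ ‖g ε p‖ := fun ε =>
    (isCompact_closedBall _ _).exists_isMaxOn
      ⟨x₀ ε, Metric.mem_closedBall_self (Real.rpow_nonneg ε.pos.le b)⟩ (hg ε).norm.continuousOn
  choose p hp hmax using h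
  simp only [mem_closedBall_iff_norm] at hp hmax
  exact ⟨p, hp, hmax⟩

lemma exists_mem_sharpBall {r : ℝ} (hr : 0 < r) {x₀ : moderate} {b : ℝ} (hb : -Real.log r < b)
    {p : Eps → ℂ} (hp : PowBound b (p - (x₀ : Eps → ℂ))) :
    ∃ x : moderate, (x : Eps → ℂ) = p ∧ toGenC x ∈ sharpBall (toGenC x₀) r := by
  have hm : IsModerate p := by
    have := hp.isModerate.add x₀.2
    rwa [sub_add_cancel] at this
  exact ⟨⟨p, hm⟩, rfl, (mem_sharpBall_iff hr).2 ⟨b, hb, hp⟩⟩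

/-- A power bound at all points of a sharp ball is uniform on smaller balls. -/
lemma uniform_powBound {r : ℝ} (hr : 0 < r) {x₀ : moderate} {b : ℝ} (hb : -Real.log r < b)
    {g : Eps → ℂ → ℂ} (hg : ∀ ε, Continuous (g ε)) {m : ℝ}
    (h : ∀ x : moderate, toGenC x ∈ sharpBall (toGenC x₀) r →
      PowBound m fun ε => g ε ((x : Eps → ℂ) ε)) :
    ∀ᶠ ε : Eps in atBot, ∀ q, ‖q - (x₀ : Eps → ℂ) ε‖ ≤ (ε : ℝ) ^ b → ‖g ε q‖ ≤ (ε : ℝ) ^ m := by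
  obtain ⟨p, hp, hmax⟩ := exists_isMax_on_balls hg x₀ b
  obtain ⟨x, rfl, hx⟩ := exists_mem_sharpBall hr hb (Eventually.of_forall hp)
  filter_upwards [h x hx] with ε h1 q hq using (hmax ε q hq).trans h1

lemma uniform_isModerate {r : ℝ} (hr : 0 < r) {x₀ : moderate} {b : ℝ} (hb : -Real.log r < b)
    {g : Eps → ℂ → ℂ} (hg : ∀ ε, Continuous (g ε))
    (h : ∀ x : moderate, toGenC x ∈ sharpBall (toGenC x₀) r →
      IsModerate fun ε => g ε ((x : Eps → ℂ) ε)) :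
    ∃ m : ℝ, ∀ᶠ ε : Eps in atBot, ∀ q,
      ‖q - (x₀ : Eps → ℂ) ε‖ ≤ (ε : ℝ) ^ b → ‖g ε q‖ ≤ (ε : ℝ) ^ m := by
  obtain ⟨p, hp, hmax⟩ := exists_isMax_on_balls hg x₀ b
  obtain ⟨x, rfl, hx⟩ := exists_mem_sharpBall hr hb (Eventually.of_forall hp)
  obtain ⟨m, hm⟩ := isModerate_iff.1 (h x hx)
  exact ⟨m, by filter_upwards [hm] with ε h1 q hq using (hmax ε q hq).trans h1⟩

/-- All derivatives of order `n` are moderate with a common bound on smaller balls. -/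
lemma uniform_partialDeriv {r : ℝ} (hr : 0 < r) {x₀ : moderate} {b : ℝ} (hb : -Real.log r < b)
    (u : EModerate (sharpBall (toGenC x₀) r)) (n : ℕ) :
    ∃ m : ℝ, ∀ᶠ ε : Eps in atBot, ∀ q, ‖q - (x₀ : Eps → ℂ) ε‖ ≤ (ε : ℝ) ^ b →
      ∀ i j, i + j = n → ‖partialDeriv (i, j) ((u : Eps → ℂ → ℂ) ε) q‖ ≤ (ε : ℝ) ^ m := by
  have h : ∀ α : ℕ × ℕ, ∃ m : ℝ, ∀ᶠ ε : Eps in atBot, ∀ q,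
      ‖q - (x₀ : Eps → ℂ) ε‖ ≤ (ε : ℝ) ^ b →
        ‖partialDeriv α ((u : Eps → ℂ → ℂ) ε) q‖ ≤ (ε : ℝ) ^ m := fun α =>
    uniform_isModerate hr hb
      (fun ε => (partialDeriv_smooth α (EModerate.smooth u ε)).continuous) (u.2.2 α)
  choose m hm using h
  obtain ⟨c, hc⟩ := ((Finset.HasAntidiagonal.antidiagonal n).image m).bddBelow
  refine ⟨c, ?_⟩
  filter_upwards [(Filter.eventually_all_finset (Finset.HasAntidiagonal.antidiagonal n)).2 fun α _ => hm α]
    with ε h q hq i j hij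
  have hmem := Finset.HasAntidiagonal.mem_antidiagonal.2 (show (i, j).1 + (i, j).2 = n from hij)
  exact (h (i, j) hmem q hq).trans
    (eps_rpow_le (hc (Finset.mem_coe.2 (Finset.mem_image_of_mem m hmem))) ε)

/-- Balls around a point of the sharp ball lie in a larger ball around the centre. -/
lemma eventually_ball_subset {x x₀ : Eps → ℂ} {b₀ b c : ℝ} (hx : PowBound b₀ (x - x₀))
    (hb : b ≤ b₀) (hc : c < b) :
    ∀ᶠ ε : Eps in atBot, ∀ q, ‖q - x ε‖ ≤ (ε : ℝ) ^ b → ‖q - x₀ ε‖ ≤ (ε : ℝ) ^ c := by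
  filter_upwards [hx.mono hb, eventually_const_mul_rpow_le 2 hc] with ε h1 h2 q hq
  have h3 := norm_add_le_of_le hq h1
  rw [Pi.sub_apply, sub_add_sub_cancel] at h3
  linarith

/-! ### Diagonal choice of points -/

/-- If, for each `k`, the property `Q k` holds at some point of the ball for arbitrarily small `ε`,
then a single net in the balls has each `Q k` for arbitrarily small `ε`. -/
lemma exists_net_frequently {x₀ : Eps → ℂ} {B : Eps → ℂ → Prop} (hx₀ : ∀ ε, B ε (x₀ ε))
    {Q : ℕ → Eps → ℂ → Prop} (hQ : ∀ k, ∃ᶠ ε : Eps in atBot, ∃ q, B ε q ∧ Q k ε q) :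
    ∃ p : Eps → ℂ, (∀ ε, B ε (p ε)) ∧ ∀ k, ∃ᶠ ε : Eps in atBot, Q k ε (p ε) := by
  -- Smallness of ε is recorded by an integer, so that a subsequence of ℕ can be extracted. The
  -- first component of `Nat.unpair` visits every k infinitely often.
  set l : Eps → ℕ := fun ε => ⌊(ε : ℝ)⁻¹⌋₊ with hl
  have hlt : Tendsto l atBot atTop := by
    rw [tendsto_atTop]
    intro N
    filter_upwards [eventually_lt (show (0 : ℝ) < ((N : ℝ) + 1)⁻¹ by positivity)] with ε h
    refine Nat.le_floor ?_
    have := (lt_inv_comm₀ ε.pos (by positivity)).1 h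
    linarith
  have h1 : ∀ m : ℕ, ∃ᶠ j in atTop, ∃ ε, l ε = j ∧ ∃ q, B ε q ∧ Q (Nat.unpair m).1 ε q := by
    intro m
    refine hlt.frequently ((hQ (Nat.unpair m).1).mono fun ε h => ⟨ε, rfl, h⟩)
  obtain ⟨φ, hφ, h2⟩ := extraction_forall_of_frequently h1
  choose e he q hq hQq using h2
  -- The chosen parameters are distinct, so the requirements never compete for the same ε.
  have hinj : Function.Injective e := fun m n h => hφ.injective (by rw [← he, ← he, h])
  refine ⟨Function.extend e q x₀, fun ε => ?_, fun k => ?_⟩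
  · by_cases h : ∃ m, e m = ε
    · obtain ⟨m, rfl⟩ := h
      rw [hinj.extend_apply]
      exact hq m
    · rw [Function.extend_apply' _ _ _ h]
      exact hx₀ ε
  · rw [frequently_iff]
    intro U hU
    obtain ⟨ε₀, h0⟩ := mem_atBot_sets.1 hU
    set m := Nat.pair k (l ε₀ + 1) with hm
    have hk : (Nat.unpair m).1 = k := by rw [hm, Nat.unpair_pair]
    refine ⟨e m, h0 _ ?_, ?_⟩
    · have h3 : l ε₀ < l (e m) := by
        rw [he]
        exact lt_of_lt_of_le (Nat.lt_succ_self _) ((Nat.right_le_pair _ _).trans (hφ.id_le m))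
      by_contra hlt'
      have h4 : (ε₀ : ℝ) < e m := not_le.1 hlt'
      have h5 : l (e m) ≤ l ε₀ := Nat.floor_le_floor (inv_anti₀ ε₀.pos h4.le)
      omega
    · rw [hinj.extend_apply, ← hk]
      exact hQq m

/-! ### Almost holomorphic nets -/

/-- Each ∂_y is exchanged for i∂_x at the cost of a negligible term. -/
lemma CRNegligibleAt.isNegligible_sub {u : Eps → ℂ → ℂ} {x : Eps → ℂ} (h : CRNegligibleAt u x)
    (i j : ℕ) : IsNegligible fun ε => partialDeriv (i, j) (u ε) (x ε)
      - Complex.I ^ j * partialDeriv (i + j, 0) (u ε) (x ε) := by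
  induction j generalizing i with
  | zero =>
    convert IsNegligible.zero using 1
    ext ε
    simp
  | succ j ih =>
    convert (h i j).add (IsNegligible.moderate_mul (IsModerate.const Complex.I) (ih (i + 1)))
      using 1
    ext ε
    simp only [Pi.add_apply, Pi.mul_apply]
    rw [show i + 1 + j = i + (j + 1) by ring]
    ring

/-- The deviation of the derivatives up to order `n` from those of a holomorphic function is
eventually as small as desired. -/
lemma CRNegligibleAt.eventually_le {u : Eps → ℂ → ℂ} {x : Eps → ℂ} (h : CRNegligibleAt u x)
    (n : ℕ) (m : ℝ) : ∀ᶠ ε : Eps in atBot, ∀ k ≤ n, ∀ i j, i + j = k →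
      ‖partialDeriv (i, j) (u ε) (x ε) - Complex.I ^ j * partialDeriv (k, 0) (u ε) (x ε)‖
        ≤ (ε : ℝ) ^ m := by
  have h1 : ∀ᶠ ε : Eps in atBot, ∀ i ∈ Finset.range (n + 1), ∀ j ∈ Finset.range (n + 1),
      ‖partialDeriv (i, j) (u ε) (x ε) - Complex.I ^ j * partialDeriv (i + j, 0) (u ε) (x ε)‖
        ≤ (ε : ℝ) ^ m := by
    simp only [Filter.eventually_all_finset]
    exact fun i _ j _ => (h.isNegligible_sub i j).powBound m
  filter_upwards [h1] with ε h k hk i j hij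
  subst hij
  exact h i (Finset.mem_range.2 (by omega)) j (Finset.mem_range.2 (by omega))

lemma eps_rpow_pow (ε : Eps) (b : ℝ) (n : ℕ) : ((ε : ℝ) ^ b) ^ n = (ε : ℝ) ^ (b * n) := by
  rw [Real.rpow_mul_natCast ε.pos.le]

/-- Cauchy's estimate for the elements of `𝓖̃_H`. -/
lemma powBound_partialDeriv {r : ℝ} (hr : 0 < r) {x₀ : moderate}
    (u : EModerate (sharpBall (toGenC x₀) r))
    (hu : ∀ x : moderate, toGenC x ∈ sharpBall (toGenC x₀) r → CRNegligibleAt u x)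
    {x : moderate} {b₀ b : ℝ} (hx : PowBound b₀ ((x : Eps → ℂ) - x₀)) (hb₀ : b ≤ b₀)
    (hb : -Real.log r < b) :
    ∃ N : ℝ, ∀ i j : ℕ, PowBound (N - (i + j : ℕ) * b)
      fun ε => partialDeriv (i, j) ((u : Eps → ℂ → ℂ) ε) ((x : Eps → ℂ) ε) := by
  obtain ⟨b', hb'1, hb'2⟩ := exists_between hb
  have hxA : toGenC x ∈ sharpBall (toGenC x₀) r :=
    (mem_sharpBall_iff hr).2 ⟨b₀, hb.trans_le hb₀, hx⟩
  -- N comes from the size of u alone and is fixed before n; the root bound depends on this.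
  obtain ⟨N, hN⟩ := uniform_partialDeriv hr hb'1 u 0
  have main : ∀ n : ℕ, PowBound (N - 1 - n * b)
      fun ε => partialDeriv (n, 0) ((u : Eps → ℂ → ℂ) ε) ((x : Eps → ℂ) ε) := by
    intro n
    obtain ⟨M, hM⟩ := uniform_partialDeriv hr hb'1 u (n + 1)
    set T : ℝ := N - n * b with hT
    -- The inner radius is ρ = ε^K: 1 ≤ K gives 2ρ ≤ 1 when ε < 1/2, b ≤ K gives ρ ≤ R = ε^b, and T
    -- ≤ K + M makes the Taylor remainder over ρ^n, of size ρ·ε^M, at most ε^T.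
    obtain ⟨K, hK⟩ : ∃ K : ℝ, 1 ≤ K ∧ b ≤ K ∧ T ≤ K + M :=
      ⟨max 1 (max b (T - M)), le_max_left _ _, (le_max_left _ _).trans (le_max_right _ _), by
        linarith [(le_max_right b (T - M)).trans (le_max_right 1 _)]⟩
    obtain ⟨hK1, hKb, hKM⟩ := hK
    -- The defect is smaller than any power, so m may be chosen after K: the first inequality serves
    -- the annulus term, the second the Cauchy-Riemann error in the Taylor polynomial, both divided
    -- by ρ^n.
    obtain ⟨m, hm1, hm2⟩ : ∃ m : ℝ, T ≤ (b - K) + b + m - K * n ∧ T ≤ m - K * n :=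
      ⟨max (T + K * n) (T + K * n - 2 * b + K), by
        linarith [le_max_right (T + K * n) (T + K * n - 2 * b + K)], by
        linarith [le_max_left (T + K * n) (T + K * n - 2 * b + K)]⟩
    have hD := uniform_powBound hr hb'1 (x₀ := x₀) (m := m) (g := fun ε q =>
        dirDeriv Complex.I ((u : Eps → ℂ → ℂ) ε) q
          - Complex.I * dirDeriv 1 ((u : Eps → ℂ → ℂ) ε) q)
      (fun ε => (dirDeriv_smooth _ (EModerate.smooth u ε)).continuous.sub
        (continuous_const.mul (dirDeriv_smooth _ (EModerate.smooth u ε)).continuous))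
      (fun y hy => (hu y hy 0 0).powBound m)
    refine PowBound.of_le (n.factorial * (1 + 1 + (n + 1) + 2 ^ (n + 1))) (b := T)
      (by rw [hT]; linarith) ?_
    filter_upwards [hN, hM, hD, eventually_ball_subset hx hb₀ hb'2,
      (hu x hxA).eventually_le n m, eventually_lt (show (0 : ℝ) < 1 / 2 by norm_num)]
      with ε hN hM hD hball hδ hε2
    have hε := ε.pos
    have hρ : (0 : ℝ) < (ε : ℝ) ^ K := by positivity
    have hρR : (ε : ℝ) ^ K ≤ (ε : ℝ) ^ b := eps_rpow_le hKb ε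
    have hρ1 : 2 * (ε : ℝ) ^ K ≤ 1 := by
      have : (ε : ℝ) ^ K ≤ (ε : ℝ) ^ (1 : ℝ) := eps_rpow_le hK1 ε
      rw [Real.rpow_one] at this
      linarith
    have hf := EModerate.smooth u ε
    set f := (u : Eps → ℂ → ℂ) ε
    set z := (x : Eps → ℂ) ε
    have hE : ∀ w, ‖w‖ = (ε : ℝ) ^ K → ‖f (z + w) - ∑ k ∈ Finset.range (n + 1),
        partialDeriv (k, 0) f z / k.factorial * w ^ k‖
        ≤ (n + 1) * (ε : ℝ) ^ m + (2 * (ε : ℝ) ^ K) ^ (n + 1) * (ε : ℝ) ^ M := by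
      intro w hw
      refine (norm_sub_complex_taylor_le hf z w n (fun k => partialDeriv (k, 0) f z) hδ
        (M := (ε : ℝ) ^ M) fun t ht i j hij => hM _ (hball _ ?_) i j hij).trans ?_
      · rw [add_sub_cancel_left, norm_mul, Complex.norm_real, Real.norm_of_nonneg ht.1, hw]
        exact (mul_le_of_le_one_left hρ.le ht.2).trans hρR
      · rw [hw]
        gcongr
        calc ∑ k ∈ Finset.range (n + 1), (2 * (ε : ℝ) ^ K) ^ k
            ≤ ∑ k ∈ Finset.range (n + 1), (1 : ℝ) :=
              Finset.sum_le_sum fun k _ => pow_le_one₀ (by positivity) hρ1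
          _ = n + 1 := by simp
    have hc := norm_taylorCoeff_le hf z n (fun k => partialDeriv (k, 0) f z / k.factorial) hρ hρR
      (S := (ε : ℝ) ^ N) (D := (ε : ℝ) ^ m)
      (fun q hq => hN q (hball q hq) 0 0 rfl) (fun q hq => hD q (hball q hq)) hE
    have t1 : (ε : ℝ) ^ N / ((ε : ℝ) ^ b) ^ n = (ε : ℝ) ^ T := by
      rw [eps_rpow_pow, ← Real.rpow_sub hε, hT, mul_comm b]
    have t2 : (Real.log ((ε : ℝ) ^ b) - Real.log ((ε : ℝ) ^ K)) * (ε : ℝ) ^ b * (ε : ℝ) ^ m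
        / ((ε : ℝ) ^ K) ^ n ≤ (ε : ℝ) ^ T := by
      -- The logarithmic width of the annulus is bounded crudely by R/ρ.
      have hlog : Real.log ((ε : ℝ) ^ b) - Real.log ((ε : ℝ) ^ K) ≤ (ε : ℝ) ^ (b - K) := by
        rw [← Real.log_div (by positivity) hρ.ne', ← Real.rpow_sub hε]
        have := Real.log_le_sub_one_of_pos (show 0 < (ε : ℝ) ^ (b - K) by positivity)
        linarith
      calc _ ≤ (ε : ℝ) ^ (b - K) * (ε : ℝ) ^ b * (ε : ℝ) ^ m / ((ε : ℝ) ^ K) ^ n := by gcongr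
        _ = (ε : ℝ) ^ ((b - K) + b + m - K * n) := by
          rw [eps_rpow_pow, ← Real.rpow_add hε, ← Real.rpow_add hε, ← Real.rpow_sub hε]
        _ ≤ (ε : ℝ) ^ T := eps_rpow_le hm1 ε
    have t3 : ((n + 1) * (ε : ℝ) ^ m + (2 * (ε : ℝ) ^ K) ^ (n + 1) * (ε : ℝ) ^ M)
        / ((ε : ℝ) ^ K) ^ n ≤ (n + 1) * (ε : ℝ) ^ T + 2 ^ (n + 1) * (ε : ℝ) ^ T := by
      calc _ = (n + 1) * (ε : ℝ) ^ (m - K * n) + 2 ^ (n + 1) * (ε : ℝ) ^ (K + M) := by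
            rw [Real.rpow_sub hε, Real.rpow_add hε, ← eps_rpow_pow]
            field_simp
            ring
        _ ≤ _ := by
          gcongr ?_ * ?_ + ?_ * ?_
          · exact eps_rpow_le hm2 ε
          · exact eps_rpow_le hKM ε
    rw [t1] at hc
    have hc' := hc.trans (show _ ≤ (1 + 1 + (n + 1) + 2 ^ (n + 1)) * (ε : ℝ) ^ T by linarith)
    rw [norm_div, Complex.norm_natCast, div_le_iff₀ (by positivity)] at hc'
    exact hc'.trans_eq (by ring)
  -- One unit was lost to the constants in `main`; the second pays for replacing ∂_y by i∂_x.
  refine ⟨N - 2, fun i j => ?_⟩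
  have h1 := ((hu x hxA).isNegligible_sub i j).powBound (N - 1 - (i + j : ℕ) * b)
  have h2 : PowBound (N - 1 - (i + j : ℕ) * b) fun ε => Complex.I ^ j *
      partialDeriv (i + j, 0) ((u : Eps → ℂ → ℂ) ε) ((x : Eps → ℂ) ε) := by
    filter_upwards [main (i + j)] with ε h
    rwa [norm_mul, norm_pow, Complex.norm_I, one_pow, one_mul]
  convert h1.add h2 (c := N - 2 - (i + j : ℕ) * b) (by linarith) using 1
  ext ε
  simp

lemma rootBound_of_GenH {r : ℝ} (hr : 0 < r) {x₀ : moderate}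
    (u : EModerate (sharpBall (toGenC x₀) r))
    (hu : ∀ x : moderate, toGenC x ∈ sharpBall (toGenC x₀) r → CRNegligibleAt u x) :
    RootBound (toGen u) (1 / r) := by
  rintro ⟨z, hz⟩
  obtain ⟨x, rfl⟩ := toGenC_surjective z
  obtain ⟨b₀, hb₀, hx⟩ := (mem_sharpBall_iff hr).1 hz
  simp only [pointValue_genPartial]
  by_contra hlt
  obtain ⟨c, hc0, hc1, hc2⟩ := ENNReal.lt_iff_exists_real_btwn.1 (not_le.1 hlt)
  refine hc2.not_ge (limsup_le_of_le (by isBoundedDefault) ?_)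
  have hrc : 1 / r < c := (ENNReal.ofReal_lt_ofReal_iff_of_nonneg (by positivity)).1 hc1
  have hcpos : 0 < c := lt_trans (by positivity) hrc
  have hlog : -Real.log r < Real.log c := by
    rw [← Real.log_inv, ← one_div]
    exact Real.log_lt_log (by positivity) hrc
  obtain ⟨b, hb1, hb2⟩ := exists_between (lt_min hlog hb₀)
  obtain ⟨N, hN⟩ := powBound_partialDeriv hr u hu hx (hb2.le.trans (min_le_right _ _)) hb1
  have hbc : 0 < Real.log c - b := sub_pos.2 (hb2.trans_le (min_le_left _ _))
  -- From this order on, the slack n(log c - b) absorbs the fixed constant 1 - N.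
  obtain ⟨n₀, hn₀⟩ := exists_nat_ge (max 1 ((1 - N) / (Real.log c - b)))
  filter_upwards [preimage_mem_comap (Ici_mem_atTop n₀)] with α hα
  have hn : (n₀ : ℝ) ≤ (α.1 + α.2 : ℕ) := by exact_mod_cast hα
  refine ENNReal.ofReal_le_ofReal ?_
  have h1 := (PowBound.sharpNorm_lt (x := ⟨_, u.2.2 α x hz⟩) (hN α.1 α.2)
    (c := N - 1 - (α.1 + α.2 : ℕ) * b) (by linarith)).le
  set n : ℝ := ((α.1 + α.2 : ℕ) : ℝ)
  have hn1 : 0 < n := by linarith [le_max_left 1 ((1 - N) / (Real.log c - b))]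
  have hn2 : 1 - N ≤ n * (Real.log c - b) := by
    rw [← div_le_iff₀ hbc]
    linarith [le_max_right 1 ((1 - N) / (Real.log c - b))]
  calc _ ≤ Real.exp (-(N - 1 - n * b)) ^ (1 / n) :=
        Real.rpow_le_rpow (sharpNorm_nonneg _) h1 (by positivity)
    _ = Real.exp (-(N - 1 - n * b) / n) := by rw [← Real.exp_mul]; congr 1; ring
    _ ≤ Real.exp (Real.log c) := by
        refine Real.exp_le_exp.2 ?_
        rw [div_le_iff₀ hn1]
        linarith
    _ = c := Real.exp_log hcpos

/-! ### Sharp convergence of power series on representatives -/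

lemma sharpHasSum_iff {a : ℕ → moderate} {w v : moderate} :
    SharpHasSum (fun n => toGenC (a n) * toGenC w ^ n) (toGenC v) ↔
      ∀ m : ℝ, ∀ᶠ n in atTop, PowBound m fun ε =>
        ∑ k ∈ Finset.range n, (a k : Eps → ℂ) ε * (w : Eps → ℂ) ε ^ k - (v : Eps → ℂ) ε := by
  have h1 : ∀ n, ∑ k ∈ Finset.range n, toGenC (a k) * toGenC w ^ k - toGenC v
      = toGenC (∑ k ∈ Finset.range n, a k * w ^ k - v) := by
    intro n
    simp only [toGenC, map_sub, map_sum, map_mul, map_pow]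
  have h2 : ∀ n, ((∑ k ∈ Finset.range n, a k * w ^ k - v : moderate) : Eps → ℂ) = fun ε =>
      ∑ k ∈ Finset.range n, (a k : Eps → ℂ) ε * (w : Eps → ℂ) ε ^ k - (v : Eps → ℂ) ε := by
    intro n
    ext ε
    simp [Finset.sum_apply]
  simp only [SharpHasSum, h1, tendsto_sharpNorm_iff, h2]

/-! ### From the root bound to the power series -/

/-- The root bound at all points is uniform on smaller balls. -/
lemma RootBound.uniform {r : ℝ} (hr : 0 < r) {x₀ : moderate}
    {u : EModerate (sharpBall (toGenC x₀) r)} (hu : RootBound (toGen u) (1 / r)) {b c : ℝ}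
    (hb : -Real.log r < b) (hc : -Real.log r < c) :
    ∃ n₀ : ℕ, ∀ n ≥ n₀, ∀ i j, i + j = n → ∀ᶠ ε : Eps in atBot, ∀ q,
      ‖q - (x₀ : Eps → ℂ) ε‖ ≤ (ε : ℝ) ^ b →
        ‖partialDeriv (i, j) ((u : Eps → ℂ → ℂ) ε) q‖ ≤ (ε : ℝ) ^ (-(n * c)) := by
  -- Otherwise, for every k some derivative of order n k ≥ k breaks the bound for arbitrarily small
  -- ε; one net passing through such points for all k contradicts the root bound at the point it
  -- represents.
  by_contra! hcon
  choose n hn i j hij hfr using hcon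
  obtain ⟨p, hp, hpQ⟩ := exists_net_frequently (x₀ := (x₀ : Eps → ℂ))
    (B := fun ε q => ‖q - (x₀ : Eps → ℂ) ε‖ ≤ (ε : ℝ) ^ b)
    (fun ε => by simpa using Real.rpow_nonneg ε.pos.le b)
    (Q := fun k ε q => (ε : ℝ) ^ (-(n k * c)) <
      ‖partialDeriv (i k, j k) ((u : Eps → ℂ → ℂ) ε) q‖) hfr
  obtain ⟨x, rfl, hx⟩ := exists_mem_sharpBall hr hb (Eventually.of_forall hp)
  have hlim := hu ⟨toGenC x, hx⟩
  simp only [pointValue_genPartial] at hlim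
  have hrc : 1 / r < Real.exp c := by
    rw [one_div, ← Real.exp_log (inv_pos.2 hr), Real.log_inv]
    exact Real.exp_lt_exp.2 hc
  have hev := eventually_lt_of_limsup_lt (hlim.trans_lt
    ((ENNReal.ofReal_lt_ofReal_iff (Real.exp_pos c)).2 hrc))
  rw [eventually_comap] at hev
  obtain ⟨n₁, hn₁⟩ := eventually_atTop.1 hev
  -- The 1 keeps the order positive, as the n-th root needs.
  set k := max n₁ 1
  have hk : k ≤ n k := hn k
  have hlt := hn₁ (n k) ((le_max_left _ _).trans hk) (i k, j k) (hij k)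
  have hnpos : (0 : ℝ) < n k := by exact_mod_cast (le_max_right n₁ 1).trans hk
  simp only [hij k] at hlt
  rw [ENNReal.ofReal_lt_ofReal_iff (Real.exp_pos c), one_div,
    Real.rpow_inv_lt_iff_of_pos (sharpNorm_nonneg _) (Real.exp_pos c).le hnpos, ← Real.exp_mul,
    show c * n k = -(-(n k * c)) by ring] at hlt
  obtain ⟨d, hd, hpow⟩ := exists_powBound_of_sharpNorm_lt hlt
  obtain ⟨ε, h1, h2⟩ := ((hpQ k).and_eventually (hpow.mono hd.le)).exists
  exact absurd h2 (not_le.2 h1)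

/-- The coefficients are ∂_x^k u(z₀)/k!. For s < c < b with s = -log r, the remainder of order n + 1
is about ε^(b(n+1))·ε^(-c(n+1)), which beats every power of ε as n grows. -/
lemma isPowerSeriesSum_of_rootBound {r : ℝ} (hr : 0 < r) {x₀ : moderate}
    (u : EModerate (sharpBall (toGenC x₀) r)) (hu : RootBound (toGen u) (1 / r))
    (hcr : CRNegligibleAt u x₀) :
    IsPowerSeriesSum (pointValue (toGen u)) (toGenC x₀) := by
  have hx₀ : toGenC x₀ ∈ sharpBall (toGenC x₀) r := mem_sharpBall_self _ hr
  have hmod : ∀ k : ℕ, IsModerate fun ε =>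
      partialDeriv (k, 0) ((u : Eps → ℂ → ℂ) ε) ((x₀ : Eps → ℂ) ε) / k.factorial := fun k => by
    convert (u.2.2 (k, 0) x₀ hx₀).mul (IsModerate.const (k.factorial : ℂ)⁻¹) using 1
    ext ε
    simp [div_eq_mul_inv]
  refine ⟨fun k => toGenC ⟨_, hmod k⟩, ?_⟩
  rintro ⟨z, hz⟩
  obtain ⟨x, rfl⟩ := toGenC_surjective z
  rw [pointValue_toGen]
  change SharpHasSum (fun n => toGenC _ * toGenC (x - x₀) ^ n) _
  rw [sharpHasSum_iff]
  intro m
  obtain ⟨b, hb, hx⟩ := (mem_sharpBall_iff hr).1 hz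
  obtain ⟨c, hc1, hc2⟩ := exists_between hb
  obtain ⟨n₀, hn₀⟩ := hu.uniform hr hb hc1
  have hbc : 0 < b - c := sub_pos.2 hc2
  obtain ⟨n₁, hn₁⟩ := exists_nat_ge ((m + 1) / (b - c))
  filter_upwards [eventually_ge_atTop (max (max n₀ n₁) 1)] with N hN
  obtain ⟨n, rfl⟩ : ∃ n, N = n + 1 := ⟨N - 1, by omega⟩
  have hNn₁ : (n₁ : ℝ) ≤ ((n + 1 : ℕ) : ℝ) := by
    exact_mod_cast (le_max_right n₀ n₁).trans ((le_max_left _ _).trans hN)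
  have hexp : m + 1 ≤ (b - c) * (n + 1 : ℕ) := by
    rw [← div_le_iff₀' hbc]
    linarith
  set L := |b|
  have hder : ∀ᶠ ε : Eps in atBot, ∀ i ∈ Finset.range (n + 2), ∀ j ∈ Finset.range (n + 2),
      i + j = n + 1 → ∀ q, ‖q - (x₀ : Eps → ℂ) ε‖ ≤ (ε : ℝ) ^ b →
        ‖partialDeriv (i, j) ((u : Eps → ℂ → ℂ) ε) q‖ ≤ (ε : ℝ) ^ (-((n + 1 : ℕ) * c)) := by
    simp only [Filter.eventually_all_finset]
    intro i _ j _
    by_cases hij : i + j = n + 1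
    · filter_upwards [hn₀ (n + 1) ((le_max_left n₀ n₁).trans ((le_max_left _ _).trans hN)) i j hij]
        with ε h _ using h
    · exact Eventually.of_forall fun ε h => absurd h hij
  refine PowBound.of_le ((n + 1) * 2 ^ n + 2 ^ (n + 1)) (b := m + 1) (by linarith) ?_
  -- When b < 0 the increment w may be large; the extra L·n offsets the factor (2ε^(-L))^n bounding
  -- its powers.
  filter_upwards [hder, hcr.eventually_le n (m + 1 + L * n), hx] with ε hder hδ hx
  have hε := ε.pos
  have hf := EModerate.smooth u ε
  have hw : ((x - x₀ : moderate) : Eps → ℂ) ε = (x : Eps → ℂ) ε - (x₀ : Eps → ℂ) ε := rfl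
  have hev : (evalNet u x hz : Eps → ℂ) ε = (u : Eps → ℂ → ℂ) ε ((x : Eps → ℂ) ε) := rfl
  rw [hw, hev]
  rw [Pi.sub_apply] at hx
  set w := (x : Eps → ℂ) ε - (x₀ : Eps → ℂ) ε with hwdef
  rw [show (x : Eps → ℂ) ε = (x₀ : Eps → ℂ) ε + w by rw [hwdef]; ring, norm_sub_rev]
  refine (norm_sub_complex_taylor_le hf _ w n _ hδ
    (M := (ε : ℝ) ^ (-((n + 1 : ℕ) * c))) fun t ht i j hij => ?_).trans ?_
  · refine hder i (Finset.mem_range.2 (by omega)) j (Finset.mem_range.2 (by omega)) hij _ ?_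
    rw [add_sub_cancel_left, norm_mul, Complex.norm_real, Real.norm_of_nonneg ht.1]
    exact (mul_le_of_le_one_left (norm_nonneg _) ht.2).trans hx
  · have h1 : (1 : ℝ) ≤ 2 * (ε : ℝ) ^ (-L) := by
      have : (ε : ℝ) ^ (0 : ℝ) ≤ (ε : ℝ) ^ (-L) := eps_rpow_le (by simp [L]) ε
      rw [Real.rpow_zero] at this
      linarith
    have h2 : 2 * ‖w‖ ≤ 2 * (ε : ℝ) ^ (-L) := by
      have : (ε : ℝ) ^ b ≤ (ε : ℝ) ^ (-L) := eps_rpow_le (neg_abs_le b) ε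
      linarith
    have h3 : ∑ k ∈ Finset.range (n + 1), (2 * ‖w‖) ^ k
        ≤ (n + 1) * (2 * (ε : ℝ) ^ (-L)) ^ n := by
      calc _ ≤ ∑ k ∈ Finset.range (n + 1), (2 * (ε : ℝ) ^ (-L)) ^ n := by
            refine Finset.sum_le_sum fun k hk => ?_
            exact (pow_le_pow_left₀ (by positivity) h2 k).trans
              (pow_le_pow_right₀ h1 (Nat.lt_succ_iff.1 (Finset.mem_range.1 hk)))
        _ = _ := by simp
    calc _ ≤ (n + 1) * (2 * (ε : ℝ) ^ (-L)) ^ n * (ε : ℝ) ^ (m + 1 + L * n)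
          + (2 * (ε : ℝ) ^ b) ^ (n + 1) * (ε : ℝ) ^ (-((n + 1 : ℕ) * c)) := by gcongr
      _ = (n + 1) * 2 ^ n * (ε : ℝ) ^ (m + 1)
          + 2 ^ (n + 1) * (ε : ℝ) ^ ((b - c) * (n + 1 : ℕ)) := by
        rw [mul_pow, mul_pow, eps_rpow_pow, eps_rpow_pow]
        congr 1
        · rw [mul_assoc, mul_assoc, ← Real.rpow_add hε, ← mul_assoc]
          ring_nf
        · rw [mul_assoc, ← Real.rpow_add hε]
          ring_nf
      _ ≤ (n + 1) * 2 ^ n * (ε : ℝ) ^ (m + 1) + 2 ^ (n + 1) * (ε : ℝ) ^ (m + 1) := by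
        gcongr _ + _ * ?_
        exact eps_rpow_le hexp ε
      _ = _ := by ring

/-! ### Nets of entire functions -/

lemma dirDeriv_iter_of_differentiable (v : ℂ) {f : ℂ → ℂ} (hf : Differentiable ℂ f) (n : ℕ) :
    (dirDeriv v)^[n] f = v ^ n • iteratedDeriv n f := by
  have hd : ∀ n, Differentiable ℂ (iteratedDeriv n f) := fun n =>
    (hf.contDiff (n := ∞)).differentiable_iteratedDeriv n (by exact_mod_cast ENat.natCast_lt_top n)
  induction n with
  | zero => simp
  | succ n ih =>
    rw [Function.iterate_succ_apply', ih]
    ext z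
    have h1 := ((hd n z).hasDerivAt.const_mul (v ^ n)).hasFDerivAt.restrictScalars ℝ
    have h2 : dirDeriv v (v ^ n • iteratedDeriv n f) z = _ :=
      congrArg (fun L : ℂ →L[ℝ] ℂ => L v) h1.fderiv
    rw [h2, iteratedDeriv_succ]
    simp [pow_succ]
    ring

lemma partialDeriv_of_differentiable (α : ℕ × ℕ) {f : ℂ → ℂ} (hf : Differentiable ℂ f) (z : ℂ) :
    partialDeriv α f z = Complex.I ^ α.2 * iteratedDeriv (α.1 + α.2) f z := by
  have hd : Differentiable ℂ (iteratedDeriv α.2 f) :=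
    (hf.contDiff (n := ∞)).differentiable_iteratedDeriv _
      (by exact_mod_cast ENat.natCast_lt_top α.2)
  rw [partialDeriv, dirDeriv_iter_of_differentiable _ hf,
    dirDeriv_iter_of_differentiable _ (hd.const_smul _)]
  simp only [one_pow, one_smul]
  rw [iteratedDeriv_const_smul_field, iteratedDeriv_eq_iterate,
    iteratedDeriv_eq_iterate, iteratedDeriv_eq_iterate, ← Function.iterate_add_apply, smul_eq_mul]

lemma crNegligibleAt_of_differentiable {u : Eps → ℂ → ℂ} (hu : ∀ ε, Differentiable ℂ (u ε))
    (x : Eps → ℂ) : CRNegligibleAt u x := by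
  intro i j
  convert IsNegligible.zero using 1
  ext ε
  rw [partialDeriv_of_differentiable _ (hu ε), partialDeriv_of_differentiable _ (hu ε)]
  simp only [Pi.zero_apply]
  rw [show i + 1 + j = i + (j + 1) by ring]
  ring

/-- For entire functions, Cauchy's estimates on circles of radius ε^b yield moderate derivatives
from moderate values. -/
lemma mem_EModerate_of_differentiable {r : ℝ} (hr : 0 < r) {x₀ : moderate} {u : Eps → ℂ → ℂ}
    (hu : ∀ ε, Differentiable ℂ (u ε))
    (h : ∀ x : moderate, toGenC x ∈ sharpBall (toGenC x₀) r →
      IsModerate fun ε => u ε ((x : Eps → ℂ) ε)) :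
    u ∈ EModerate (sharpBall (toGenC x₀) r) := by
  refine ⟨fun ε => ((hu ε).contDiff (n := ∞)).restrict_scalars ℝ, fun α x hx => ?_⟩
  obtain ⟨b, hb, hxb⟩ := (mem_sharpBall_iff hr).1 hx
  obtain ⟨c, hc, hcb⟩ := exists_between hb
  obtain ⟨m, hm⟩ := uniform_isModerate hr hc (fun ε => (hu ε).continuous) h
  set n := α.1 + α.2
  refine PowBound.isModerate (b := m - b * n - 1)
    (PowBound.of_le n.factorial (b := m - b * n) (by linarith) ?_)
  filter_upwards [hm, eventually_ball_subset hxb le_rfl hcb] with ε hm hball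
  have hε := ε.pos
  rw [partialDeriv_of_differentiable _ (hu ε), norm_mul, norm_pow, Complex.norm_I, one_pow, one_mul]
  refine (Complex.norm_iteratedDeriv_le_of_forall_mem_sphere_norm_le n
    (Real.rpow_pos_of_pos hε b) (hu ε).diffContOnCl
    fun q hq => hm q (hball q (mem_sphere_iff_norm.1 hq).le)).trans_eq ?_
  rw [eps_rpow_pow, mul_div_assoc, ← Real.rpow_sub hε]

/-! ### From the power series to a polynomial representative -/

lemma powBound_coeff_of_sharpHasSum {r : ℝ} (hr : 0 < r) {x₀ : moderate} {a : ℕ → moderate}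
    {f : sharpBall (toGenC x₀) r → GenC}
    (hf : ∀ z : sharpBall (toGenC x₀) r,
      SharpHasSum (fun n => toGenC (a n) * ((z : GenC) - toGenC x₀) ^ n) (f z))
    {b : ℝ} (hb : -Real.log r < b) (m : ℝ) :
    ∀ᶠ n : ℕ in atTop, PowBound (m - n * b) (a n : Eps → ℂ) := by
  -- Test the series at x₀ + ε^b: the difference of consecutive partial sums is a n · ε^(bn), and it
  -- becomes arbitrarily small.
  set w : Eps → ℂ := fun ε => (((ε : ℝ) ^ b : ℝ) : ℂ)
  have hwn : ∀ ε, ‖w ε‖ = (ε : ℝ) ^ b := fun ε => by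
    rw [Complex.norm_real, Real.norm_of_nonneg (Real.rpow_nonneg ε.pos.le b)]
  obtain ⟨x, hxp, hx⟩ := exists_mem_sharpBall hr hb (x₀ := x₀) (p := x₀ + w)
    (Eventually.of_forall fun ε => by simp [hwn])
  obtain ⟨v, hv⟩ := toGenC_surjective (f ⟨toGenC x, hx⟩)
  have h := hf ⟨toGenC x, hx⟩
  rw [← hv] at h
  have h := (sharpHasSum_iff (w := x - x₀)).1 h (m + 1)
  have hw : ((x - x₀ : moderate) : Eps → ℂ) = w := by
    change (x : Eps → ℂ) - x₀ = w
    rw [hxp, add_sub_cancel_left]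
  rw [hw] at h
  filter_upwards [h, (tendsto_add_atTop_nat 1).eventually h] with n h1 h2
  have h3 := h2.add h1.neg (c := m) (by linarith)
  filter_upwards [h3] with ε h3
  simp only [Pi.add_apply, Pi.neg_apply, Finset.sum_range_succ] at h3
  rw [← sub_eq_add_neg, sub_sub_sub_cancel_right, add_sub_cancel_left, norm_mul, norm_pow, hwn,
    eps_rpow_pow, mul_comm b] at h3
  rwa [Real.rpow_sub ε.pos, le_div_iff₀ (Real.rpow_pos_of_pos ε.pos _)]

/-- Coefficients with the asymptotic bounds of a power series convergent on a sharp ball have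
representatives for which these bounds hold for all `ε`. -/
lemma exists_uniform_coeff {s : ℝ} {a : ℕ → Eps → ℂ}
    (ha : ∀ b, s < b → ∀ m : ℝ, ∀ᶠ n : ℕ in atTop, PowBound (m - n * b) (a n)) :
    ∃ t : ℕ → Eps → ℂ, (∀ n, ∀ᶠ ε : Eps in atBot, t n ε = a n ε) ∧
      ∀ b, s < b → ∀ m : ℝ, ∃ n₁ : ℕ, ∀ n ≥ n₁, ∀ ε : Eps, ‖t n ε‖ ≤ (ε : ℝ) ^ (m - n * b) := by
  have h1 : ∀ j : ℕ, ∃ N : ℕ, ∀ n ≥ N, PowBound (j - n * (s + 1 / ((j : ℝ) + 1))) (a n) := fun j =>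
    eventually_atTop.1 (ha _ (lt_add_of_pos_right s (by positivity)) j)
  choose N hN using h1
  classical
  -- The exponents s + 1/(j+1) and powers j form a countable cofinal family of bounds. A value is
  -- set to 0 when it breaks one of the finitely many bounds already in force at index n, which
  -- happens for no small ε.
  refine ⟨fun n ε => if ∀ j ∈ Finset.range (n + 1), N j ≤ n →
    ‖a n ε‖ ≤ (ε : ℝ) ^ (j - n * (s + 1 / ((j : ℝ) + 1))) then a n ε else 0, fun n => ?_,
    fun b hb m => ?_⟩
  · have : ∀ᶠ ε : Eps in atBot, ∀ j ∈ Finset.range (n + 1), N j ≤ n →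
        ‖a n ε‖ ≤ (ε : ℝ) ^ (j - n * (s + 1 / ((j : ℝ) + 1))) := by
      rw [Filter.eventually_all_finset]
      intro j _
      by_cases h : N j ≤ n
      · filter_upwards [hN j n h] with ε h2 _ using h2
      · exact Eventually.of_forall fun ε h2 => absurd h2 h
    filter_upwards [this] with ε h
    rw [if_pos h]
  · obtain ⟨j₁, hj₁⟩ := exists_nat_one_div_lt (sub_pos.2 hb)
    obtain ⟨j₂, hj₂⟩ := exists_nat_ge m
    set j := max j₁ j₂
    have hjb : s + 1 / ((j : ℝ) + 1) ≤ b := by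
      have : 1 / ((j : ℝ) + 1) ≤ 1 / ((j₁ : ℝ) + 1) :=
        Nat.one_div_le_one_div (le_max_left _ _)
      linarith
    have hjm : m ≤ j := hj₂.trans (by exact_mod_cast le_max_right j₁ j₂)
    refine ⟨max j (N j), fun n hn ε => ?_⟩
    dsimp only
    split_ifs with h
    · refine (h j (Finset.mem_range.2 (Nat.lt_succ_iff.2 ((le_max_left _ _).trans hn)))
        ((le_max_right _ _).trans hn)).trans (eps_rpow_le ?_ ε)
      have : (n : ℝ) * (s + 1 / ((j : ℝ) + 1)) ≤ n * b := by gcongr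
      linarith
    · simpa using Real.rpow_nonneg ε.pos.le _

/-- The polynomial `∑_{n ≤ 1/ε} t_{n,ε} (z - x_ε)^n`. -/
noncomputable def truncSeries (t : ℕ → Eps → ℂ) (x : Eps → ℂ) (ε : Eps) : Polynomial ℂ :=
  ∑ n ∈ Finset.range (⌊(ε : ℝ)⁻¹⌋₊ + 1),
    Polynomial.C (t n ε) * (Polynomial.X - Polynomial.C (x ε)) ^ n

lemma eval_truncSeries (t : ℕ → Eps → ℂ) (x : Eps → ℂ) (ε : Eps) (z : ℂ) :
    (truncSeries t x ε).eval z
      = ∑ n ∈ Finset.range (⌊(ε : ℝ)⁻¹⌋₊ + 1), t n ε * (z - x ε) ^ n := by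
  simp [truncSeries, Polynomial.eval_finsetSum]

/-- For fixed N the first N terms agree for small ε, and the rest is dominated by a geometric series
of ratio ε^(b-c) ≤ 1/2. The number of remaining terms grows as ε → 0, so coefficient bounds valid
for all n and ε at once are needed. -/
lemma powBound_sum_sub_truncSeries {s : ℝ} {a t : ℕ → Eps → ℂ} {x x₀ : Eps → ℂ}
    (hta : ∀ n, ∀ᶠ ε : Eps in atBot, t n ε = a n ε)
    (ht : ∀ b, s < b → ∀ m : ℝ, ∃ n₁ : ℕ, ∀ n ≥ n₁, ∀ ε : Eps, ‖t n ε‖ ≤ (ε : ℝ) ^ (m - n * b))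
    {b : ℝ} (hb : s < b) (hx : PowBound b (x - x₀)) (m : ℝ) :
    ∀ᶠ N in atTop, PowBound m fun ε => ∑ k ∈ Finset.range N, a k ε * (x - x₀) ε ^ k
      - (truncSeries t x₀ ε).eval (x ε) := by
  obtain ⟨c, hc, hcb⟩ := exists_between hb
  obtain ⟨n₁, hn₁⟩ := ht c hc (m + 1)
  filter_upwards [eventually_ge_atTop n₁] with N hN
  refine PowBound.of_le 2 (b := m + 1) (by linarith) ?_
  have hta' : ∀ᶠ ε : Eps in atBot, ∀ k ∈ Finset.range N, t k ε = a k ε := by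
    rw [Filter.eventually_all_finset]
    exact fun k _ => hta k
  filter_upwards [hta', hx, eventually_const_mul_rpow_le 2 (sub_pos.2 hcb),
    eventually_lt (show (0 : ℝ) < ((N : ℝ) + 1)⁻¹ by positivity)] with ε h1 h2 h3 h4
  have hε := ε.pos
  have hNL : N ≤ ⌊(ε : ℝ)⁻¹⌋₊ + 1 := by
    have := (lt_inv_comm₀ hε (by positivity)).1 h4
    have : N ≤ ⌊(ε : ℝ)⁻¹⌋₊ := Nat.le_floor (by linarith)
    omega
  set L := ⌊(ε : ℝ)⁻¹⌋₊ + 1 with hL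
  rw [eval_truncSeries, ← hL, Finset.sum_congr rfl fun k hk => by rw [← h1 k hk], norm_sub_rev]
  change ‖∑ n ∈ Finset.range L, t n ε * (x - x₀) ε ^ n - _‖ ≤ _
  rw [← Finset.sum_Ico_eq_sub _ hNL]
  have hhalf : (ε : ℝ) ^ (b - c) ≤ 1 / 2 := by
    rw [Real.rpow_zero] at h3
    linarith
  calc _ ≤ ∑ k ∈ Finset.Ico N L, (ε : ℝ) ^ (m + 1) * (1 / 2) ^ k := by
        refine norm_sum_le_of_le _ fun k hk => ?_
        rw [norm_mul, norm_pow]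
        calc _ ≤ (ε : ℝ) ^ (m + 1 - k * c) * ((ε : ℝ) ^ b) ^ k := by
              gcongr
              exact hn₁ k (hN.trans (Finset.mem_Ico.1 hk).1) ε
          _ = (ε : ℝ) ^ (m + 1) * ((ε : ℝ) ^ (b - c)) ^ k := by
              rw [eps_rpow_pow, eps_rpow_pow, ← Real.rpow_add hε, ← Real.rpow_add hε]
              ring_nf
          _ ≤ _ := by gcongr
    _ ≤ ∑ k ∈ Finset.range L, (ε : ℝ) ^ (m + 1) * (1 / 2) ^ k := by
        refine Finset.sum_le_sum_of_subset_of_nonneg ?_ fun k _ _ => by positivity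
        intro k hk
        exact Finset.mem_range.2 (Finset.mem_Ico.1 hk).2
    _ ≤ 2 * (ε : ℝ) ^ (m + 1) := by
        rw [← Finset.mul_sum, mul_comm]
        gcongr
        exact sum_geometric_two_le L

lemma exists_polynomialRep_of_isPowerSeriesSum {r : ℝ} (hr : 0 < r) {x₀ : moderate}
    {f : sharpBall (toGenC x₀) r → GenC} (hf : IsPowerSeriesSum f (toGenC x₀)) :
    ∃ U : Gen (sharpBall (toGenC x₀) r), pointValue U = f ∧ HasPolynomialRep U := by
  obtain ⟨a', hf⟩ := hf
  choose a ha using fun n => toGenC_surjective (a' n)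
  simp only [← ha] at hf
  obtain ⟨t, hta, ht⟩ := exists_uniform_coeff (a := fun n => (a n : Eps → ℂ))
    fun b hb m => powBound_coeff_of_sharpHasSum hr hf hb m
  have key : ∀ x : moderate, toGenC x ∈ sharpBall (toGenC x₀) r → ∀ m, ∀ᶠ N in atTop,
      PowBound m fun ε => ∑ k ∈ Finset.range N, (a k : Eps → ℂ) ε * ((x : Eps → ℂ) - x₀) ε ^ k
        - (truncSeries t x₀ ε).eval ((x : Eps → ℂ) ε) := by
    intro x hx
    obtain ⟨b, hb, hxb⟩ := (mem_sharpBall_iff hr).1 hx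
    exact powBound_sum_sub_truncSeries hta ht hb hxb
  have hmem : (fun ε z => (truncSeries t x₀ ε).eval z) ∈ EModerate (sharpBall (toGenC x₀) r) := by
    refine mem_EModerate_of_differentiable hr (fun ε => (truncSeries t x₀ ε).differentiable) ?_
    intro x hx
    -- One partial sum suffices: it is moderate, and the truncation differs from it by a bounded
    -- net.
    obtain ⟨N, hN⟩ := (key x hx 0).exists
    have h1 := (∑ k ∈ Finset.range N, a k * (x - x₀) ^ k).2.add hN.isModerate.neg
    convert h1 using 1
    ext ε
    simp [Finset.sum_apply]
  refine ⟨toGen ⟨_, hmem⟩, ?_, ⟨_, hmem⟩, rfl, fun ε => ⟨_, fun z => rfl⟩⟩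
  ext ⟨z, hz⟩
  obtain ⟨x, rfl⟩ := toGenC_surjective z
  obtain ⟨v, hv⟩ := toGenC_surjective (f ⟨toGenC x, hz⟩)
  have h := hf ⟨toGenC x, hz⟩
  rw [← hv] at h ⊢
  rw [pointValue_toGen, toGenC_eq_iff, isNegligible_iff]
  intro m
  obtain ⟨N, h1, h2⟩ :=
    (((sharpHasSum_iff (w := x - x₀)).1 h (m + 1)).and (key x hz (m + 1))).exists
  convert h1.add h2.neg (c := m) (by linarith) using 1
  ext ε
  simp [evalNet]

/-! ### Determination by point values -/

/-- A difference quotient with step h = ε^K: negligible values stay negligible after division by h,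
while moderate second derivatives leave an error of order h·ε^M, made small by the choice of K. -/
lemma isNegligible_dirDeriv {r : ℝ} (hr : 0 < r) {x₀ : moderate}
    (u : EModerate (sharpBall (toGenC x₀) r))
    (hu : ∀ x : moderate, toGenC x ∈ sharpBall (toGenC x₀) r →
      IsNegligible fun ε => (u : Eps → ℂ → ℂ) ε ((x : Eps → ℂ) ε))
    {v : ℂ} (hv : ‖v‖ = 1) (x : moderate) (hx : toGenC x ∈ sharpBall (toGenC x₀) r) :
    IsNegligible fun ε => dirDeriv v ((u : Eps → ℂ → ℂ) ε) ((x : Eps → ℂ) ε) := by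
  rw [isNegligible_iff]
  intro T
  obtain ⟨b, hb, hxb⟩ := (mem_sharpBall_iff hr).1 hx
  obtain ⟨c, hc, hcb⟩ := exists_between hb
  obtain ⟨M, hM⟩ := uniform_partialDeriv hr hc u 2
  obtain ⟨K, hKb, hKM⟩ : ∃ K : ℝ, b ≤ K ∧ T + 1 ≤ K + M :=
    ⟨max b (T + 1 - M), le_max_left _ _, by linarith [le_max_right b (T + 1 - M)]⟩
  have hU := uniform_powBound hr hc (m := T + 1 + K)
    (fun ε => (EModerate.smooth u ε).continuous) fun y hy => (hu y hy).powBound _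
  refine PowBound.of_le 6 (b := T + 1) (by linarith) ?_
  filter_upwards [hM, hU, eventually_ball_subset hxb le_rfl hcb] with ε hM hU hball
  have hε := ε.pos
  have hf := EModerate.smooth u ε
  set f := (u : Eps → ℂ → ℂ) ε
  set z := (x : Eps → ℂ) ε
  set h : ℝ := (ε : ℝ) ^ K with hh
  have hh0 : 0 < h := by positivity
  have hw : ‖(h : ℂ) * v‖ = h := by
    rw [norm_mul, hv, mul_one, Complex.norm_real, Real.norm_of_nonneg hh0.le]
  have hseg : ∀ t : ℝ, t ∈ Set.Icc (0 : ℝ) 1 → ‖z + t * (h * v) - z‖ ≤ (ε : ℝ) ^ b := by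
    intro t ht
    rw [add_sub_cancel_left, norm_mul, hw, Complex.norm_real, Real.norm_of_nonneg ht.1]
    exact (mul_le_of_le_one_left hh0.le ht.2).trans (eps_rpow_le hKb ε)
  have h1 := norm_sub_taylor_le hf z (h * v) 1 fun t ht =>
    norm_dirDeriv_iter_le hf (h * v) _ 2 (hM _ (hball _ (hseg t ht)))
  have hd : dirDeriv (h * v) f z = h * dirDeriv v f z := by
    have : (h : ℂ) * v = h • v := by simp
    rw [dirDeriv, this, map_smul]
    simp [dirDeriv]
  simp only [Finset.sum_range_succ, Finset.sum_range_zero, zero_add, Function.iterate_zero, id,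
    Nat.factorial_zero, Nat.cast_one, div_one, Function.iterate_one, Nat.factorial_one, hd,
    hw] at h1
  have h2 : ‖f z‖ ≤ (ε : ℝ) ^ (T + 1 + K) := hU z (hball z (by
    simpa using Real.rpow_nonneg hε.le b))
  have h3 : ‖f (z + h * v)‖ ≤ (ε : ℝ) ^ (T + 1 + K) := hU _ (hball _ (by
    simpa using hseg 1 (Set.right_mem_Icc.2 zero_le_one)))
  have h4 : h * ‖dirDeriv v f z‖ ≤ h * (6 * (ε : ℝ) ^ (T + 1)) := by
    calc h * ‖dirDeriv v f z‖ = ‖(h : ℂ) * dirDeriv v f z‖ := by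
          rw [norm_mul, Complex.norm_real, Real.norm_of_nonneg hh0.le]
      _ = ‖f (z + h * v) - f z - (f (z + h * v) - (f z + h * dirDeriv v f z))‖ := by
          congr 1; ring
      _ ≤ (ε : ℝ) ^ (T + 1 + K) + (ε : ℝ) ^ (T + 1 + K) + (2 * h) ^ 2 * (ε : ℝ) ^ M :=
          norm_sub_le_of_le (norm_sub_le_of_le h3 h2) h1
      _ = h * (2 * (ε : ℝ) ^ (T + 1) + 4 * (ε : ℝ) ^ (K + M)) := by
          rw [Real.rpow_add hε (T + 1), Real.rpow_add hε K, ← hh]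
          ring
      _ ≤ h * (2 * (ε : ℝ) ^ (T + 1) + 4 * (ε : ℝ) ^ (T + 1)) := by
          gcongr h * (_ + 4 * ?_)
          exact eps_rpow_le hKM ε
      _ = _ := by ring
  exact le_of_mul_le_mul_left h4 hh0

lemma mem_ENegligible_of_values {r : ℝ} (hr : 0 < r) {x₀ : moderate}
    (u : EModerate (sharpBall (toGenC x₀) r))
    (hu : ∀ x : moderate, toGenC x ∈ sharpBall (toGenC x₀) r →
      IsNegligible fun ε => (u : Eps → ℂ → ℂ) ε ((x : Eps → ℂ) ε)) :
    (u : Eps → ℂ → ℂ) ∈ ENegligible (sharpBall (toGenC x₀) r) := by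
  refine ⟨EModerate.smooth u, fun α x hx => ?_⟩
  have hy : ∀ n, ∀ x : moderate, toGenC x ∈ sharpBall (toGenC x₀) r →
      IsNegligible fun ε => (netDy^[n] u : Eps → ℂ → ℂ) ε ((x : Eps → ℂ) ε) := by
    intro n
    induction n with
    | zero => exact hu
    | succ n ih =>
      rw [Function.iterate_succ_apply']
      exact isNegligible_dirDeriv hr _ ih (by simp)
  have hxy : ∀ n, ∀ x : moderate, toGenC x ∈ sharpBall (toGenC x₀) r →
      IsNegligible fun ε => (netDx^[n] (netDy^[α.2] u) : Eps → ℂ → ℂ) ε ((x : Eps → ℂ) ε) := by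
    intro n
    induction n with
    | zero => exact hy α.2
    | succ n ih =>
      rw [Function.iterate_succ_apply']
      exact isNegligible_dirDeriv hr _ ih (by simp)
  simp only [← netPartial_apply]
  exact hxy α.1 x hx

lemma pointValue_injective {r : ℝ} (hr : 0 < r) {x₀ : moderate} :
    Function.Injective (pointValue (A := sharpBall (toGenC x₀) r)) := by
  intro U V h
  obtain ⟨u, rfl⟩ := toGen_surjective U
  obtain ⟨v, rfl⟩ := toGen_surjective V
  rw [toGen_eq_iff]
  refine mem_ENegligible_of_values hr (u - v) fun x hx => ?_
  have h1 := congrFun h ⟨toGenC x, hx⟩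
  rw [pointValue_toGen, pointValue_toGen, toGenC_eq_iff] at h1
  exact h1

/-! ### The equivalences -/

lemma mem_GenH_of_hasPolynomialRep {A : Set GenC} {U : Gen A} (hU : HasPolynomialRep U) :
    U ∈ GenH A := by
  obtain ⟨u, rfl, hp⟩ := hU
  rw [toGen_mem_GenH_iff]
  refine fun x _ => crNegligibleAt_of_differentiable (fun ε => ?_) x
  obtain ⟨p, hp⟩ := hp ε
  rw [funext hp]
  exact p.differentiable

lemma tfae_generalized_holomorphic (z₀ : GenC) {r : ℝ} (hr : 0 < r) (U : Gen (sharpBall z₀ r)) :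
    List.TFAE [U ∈ GenH (sharpBall z₀ r),
      RootBound U (1 / r) ∧ DbarVanishesAt U ⟨z₀, mem_sharpBall_self z₀ hr⟩,
      IsPowerSeriesSum (pointValue U) z₀,
      HasPolynomialRep U] := by
  obtain ⟨x₀, rfl⟩ := toGenC_surjective z₀
  obtain ⟨u, rfl⟩ := toGen_surjective U
  tfae_have 1 → 2 := by
    rw [toGen_mem_GenH_iff, dbarVanishesAt_iff]
    exact fun h => ⟨rootBound_of_GenH hr u h, h x₀ (mem_sharpBall_self _ hr)⟩
  tfae_have 2 → 3 := by
    rw [dbarVanishesAt_iff]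
    exact fun h => isPowerSeriesSum_of_rootBound hr u h.1 h.2
  -- The polynomial net is built from the values alone; injectivity of point values identifies its
  -- class with the given one.
  tfae_have 3 → 4 := by
    intro h
    obtain ⟨V, hV, hp⟩ := exists_polynomialRep_of_isPowerSeriesSum hr h
    rwa [← pointValue_injective hr hV]
  tfae_have 4 → 1 := mem_GenH_of_hasPolynomialRep
  tfae_finish

end Colombeau

theorem mainTheorem1 (z₀ : Colombeau.GenC) (r : ℝ) (hr : 0 < r) :
    (∀ U : Colombeau.Gen (Colombeau.sharpBall z₀ r),
      List.TFAE [
        U ∈ Colombeau.GenH (Colombeau.sharpBall z₀ r),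
        Colombeau.RootBound U (1 / r) ∧
          Colombeau.DbarVanishesAt U ⟨z₀, Colombeau.mem_sharpBall_self z₀ hr⟩,
        Colombeau.IsPowerSeriesSum (Colombeau.pointValue U) z₀,
        Colombeau.HasPolynomialRep U]) ∧
    (∀ u : Colombeau.sharpBall z₀ r → Colombeau.GenC,
      List.TFAE [
        ∃ U : Colombeau.Gen (Colombeau.sharpBall z₀ r), Colombeau.pointValue U = u ∧
          U ∈ Colombeau.GenH (Colombeau.sharpBall z₀ r),
        ∃ U : Colombeau.Gen (Colombeau.sharpBall z₀ r), Colombeau.pointValue U = u ∧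
          Colombeau.RootBound U (1 / r) ∧
            Colombeau.DbarVanishesAt U ⟨z₀, Colombeau.mem_sharpBall_self z₀ hr⟩,
        Colombeau.IsPowerSeriesSum u z₀,
        ∃ U : Colombeau.Gen (Colombeau.sharpBall z₀ r), Colombeau.pointValue U = u ∧
          Colombeau.HasPolynomialRep U]) := by
  have h := Colombeau.tfae_generalized_holomorphic z₀ hr
  refine ⟨h, fun u => ?_⟩
  tfae_have 1 → 2 := fun ⟨U, hU, h1⟩ => ⟨U, hU, ((h U).out 0 1).1 h1⟩
  tfae_have 2 → 3 := fun ⟨U, hU, h2⟩ => hU ▸ ((h U).out 1 2).1 h2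
  -- The only implication that must produce a generalized function from a bare map; the others keep
  -- the same U and use the first half.
  tfae_have 3 → 4 := by
    intro h3
    obtain ⟨x₀, rfl⟩ := Colombeau.toGenC_surjective z₀
    exact Colombeau.exists_polynomialRep_of_isPowerSeriesSum hr h3
  tfae_have 4 → 1 := fun ⟨U, hU, h4⟩ => ⟨U, hU, ((h U).out 0 3).2 h4⟩
  tfae_finish
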